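/- Let $\Gamma$ be a finite simple graph with vertex set $V$, let $G$ be the right-angled Coxeter group defined by $\Gamma$ (generators $V$; relations $s^2=1$ for $s\in V$ and $st=ts$ for adjacent $s,t$), let $\tilde Y$ be its Davis complex (vertex set $G$; one $n$-cube for each left coset of a subgroup generated by $n$ pairwise commuting distinct generators), and let $Y=G\backslash\tilde Y$. Although $G$ inverts edges of $\tilde Y$, it acts freely on its vertices; so $Y$ is regarded as a complex of parametrized cubes glued along isometries of faces in which a cube may be glued to itself, it has one vertex, and the link of this vertex is the link of a vertex of $\tilde Y$, that is, the flag complex of $\Gamma$. The oriented edges of $Y$ correspond to the elements of $V$. A cubical map $f\colon X\to Y$ thus labels the edges of $X$ by $V$ and induces maps of links $f_v$. Let $H\le G$ be a torsion-free subgroup generated by finitely many elements, represented by nonempty words $w_1,\dots,w_k$ in $V$. Let $X$ be the bouquet of $k$ circles with base point $p$, the $i$-th circle being subdivided into as many edges as $w_i$ has letters and labeled by $w_i$; this gives a cubical map $f\colon X\to Y$ and also makes $X$ a $\Gamma$-labeled complex, i.e. a cube complex with edges labeled by $V$ such that in each square parallel edges have equal labels and adjacent edges have labels adjacent in $\Gamma$.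 *The cubical completion.* A cubical completion $(\iota\colon X\to\hat X,\ \hat f\colon\hat X\to Y)$ is the direct limit of a sequence $X=X_0\to X_1\to X_2\to\cdots$ of complexes with cubical maps to $Y$, where $X_{m+1}$ is obtained from $X_m$ by the following round. (1) Fold, i.e. identify two distinct oriented edges with a common initial vertex and the same image in $Y$, until no fold is possible. (2) Then identify two distinct parametrized cubes of dimension $\ge 2$ with equal $1$-skeleta, until this is no longer possible. (3) Then, simultaneously for each set of $n\ge 2$ vertices of the link of a vertex $v$ whose images under $f_v$ are the vertices of an $(n-1)$-simplex but which do not span an $(n-1)$-simplex in the link of $v$, attach one $n$-cube along the corresponding $n$ edges at $v$, mapped to the corresponding cube of $Y$. *The Dani–Levcovitz standard completion.* A standard completion $j\colon X\to\Omega$ of the $\Gamma$-labeled complex $X$ is the direct limit of a sequence $X=\Omega_0\to\Omega_1\to\Omega_2\to\cdots$ of $\Gamma$-labeled complexes, where $\Omega_{m+1}$ is obtained from $\Omega_m$ by the following round. (1) Perform, in any order, fold operations (identify two distinct edges with the same label and a common endpoint, oriented away from it) and cube identification operations (identify two distinct cubes of dimension $\ge2$ with the same boundary), until the complex is folded, i.e.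 none of these operations is possible. (2) Then, simultaneously for each set of $n\ge 2$ edges at a common vertex whose labels are pairwise adjacent in $\Gamma$ and which are not the edges at a corner of an $n$-cube, attach one labeled $n$-cube along these edges. Then both procedures can be carried out, and their results coincide. More precisely, a cubical completion $(\iota,\hat X,\hat f)$ exists, a standard completion $(j,\Omega)$ exists, and for every choice of such limits (whatever the choices made in the two procedures): 1. $\hat X$ is a cube complex (no cube is glued to itself by a nontrivial isometry) and $\hat f$ is a local isometry, i.e. all maps of links induced by $\hat f$ are injective with full image; 2. $\Omega$ is a cube complex, is folded, and is cube-full: any $n\ge 2$ edges at a common vertex whose labels are pairwise adjacent in $\Gamma$ are the edges at a corner of an $n$-cube of $\Omega$; 3. there is exactly one isomorphism of cube complexes $\Phi\colon\hat X\to\Omega$ such that $\Phi\circ\iota=j$ (in particular $\Phi(\iota(p))=j(p)$) and such that for every edge $e$ of $\hat X$ the edge $\hat f(e)$ of $Y$ is the one corresponding to the label of $\Phi(e)$. -/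

import Mathlib

open CategoryTheory Opposite

/-! ### Cube complexes

A cube complex is encoded by its *parametrized cubes*.  The index category has one object for each
standard cube `[0,1]^n`; its morphisms are the isometries of `[0,1]^m` onto an `m`-dimensional face
of `[0,1]^n`.  A complex of cubes glued by isometries of faces is a presheaf on this category: its
value at `n` is the set of parametrized `n`-cubes (each `n`-cube is counted once for each of its
`2^n n!` parametrizations), with restriction to faces and reparametrization as the structure maps.
-/

noncomputable section

/-- The standard cube `[0,1]^dim`. -/
structure Box where
  dim : ℕ

/-- An isometry of `[0,1]^m` onto a face of `[0,1]^n`.  The coordinate `dir a` of the image of `x`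
is `x a` if `shift (dir a) = 0` and `1 - x a` if `shift (dir a) = 1`; a coordinate `i` outside the
range of `dir` is constant equal to `shift i`. -/
@[ext]
structure Box.Hom (m n : Box) where
  dir : Fin m.dim ↪ Fin n.dim
  shift : Fin n.dim → ZMod 2

/-- The effect of a face isometry on the vertices `{0,1}^m` of the standard cube. -/
def Box.Hom.vert {m n : Box} (φ : Box.Hom m n) (x : Fin m.dim → ZMod 2) : Fin n.dim → ZMod 2 :=
  φ.shift + Function.extend φ.dir x 0

theorem Box.Hom.vert_dir {m n : Box} (φ : Box.Hom m n) (x : Fin m.dim → ZMod 2) (a : Fin m.dim) :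
    φ.vert x (φ.dir a) = φ.shift (φ.dir a) + x a := by
  simp [Box.Hom.vert, φ.dir.injective.extend_apply]

theorem Box.Hom.vert_of_notMem {m n : Box} (φ : Box.Hom m n) (x : Fin m.dim → ZMod 2)
    (i : Fin n.dim) (hi : ¬ ∃ a, φ.dir a = i) : φ.vert x i = φ.shift i := by
  simp [Box.Hom.vert, Function.extend_apply' _ _ _ hi]

theorem Box.Hom.vert_add_single {m n : Box} (φ : Box.Hom m n) (x : Fin m.dim → ZMod 2)
    (a : Fin m.dim) : φ.vert (x + Pi.single a 1) = φ.vert x + Pi.single (φ.dir a) 1 := by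
  funext i
  by_cases hi : ∃ b, φ.dir b = i
  · obtain ⟨b, rfl⟩ := hi
    simp only [Pi.add_apply, Box.Hom.vert_dir, Pi.single_apply, φ.dir.injective.eq_iff, add_assoc]
  · have h : i ≠ φ.dir a := fun h => hi ⟨a, h.symm⟩
    simp [Box.Hom.vert_of_notMem _ _ _ hi, h]

/-- The identity isometry. -/
def Box.Hom.refl (n : Box) : Box.Hom n n where
  dir := Function.Embedding.refl _
  shift := 0

/-- Composition of face isometries. -/
def Box.Hom.comp {l m n : Box} (φ : Box.Hom l m) (ψ : Box.Hom m n) : Box.Hom l n where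
  dir := φ.dir.trans ψ.dir
  shift := ψ.vert φ.shift

theorem Box.Hom.vert_refl {n : Box} (x : Fin n.dim → ZMod 2) : (Box.Hom.refl n).vert x = x := by
  funext i
  have h := Box.Hom.vert_dir (Box.Hom.refl n) x i
  simpa [Box.Hom.refl] using h

theorem Box.Hom.vert_comp {l m n : Box} (φ : Box.Hom l m) (ψ : Box.Hom m n)
    (x : Fin l.dim → ZMod 2) : (φ.comp ψ).vert x = ψ.vert (φ.vert x) := by
  funext i
  by_cases hi : ∃ b, ψ.dir b = i
  · obtain ⟨b, rfl⟩ := hi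
    by_cases hb : ∃ a, φ.dir a = b
    · obtain ⟨a, rfl⟩ := hb
      have h := Box.Hom.vert_dir (φ.comp ψ) x a
      simp only [Box.Hom.comp, Function.Embedding.trans_apply, Box.Hom.vert_dir] at h ⊢
      rw [h, add_assoc]
    · have h : ¬ ∃ a, (φ.comp ψ).dir a = ψ.dir b := by
        rintro ⟨a, ha⟩
        exact hb ⟨a, ψ.dir.injective ha⟩
      rw [Box.Hom.vert_of_notMem _ _ _ h, Box.Hom.vert_dir, Box.Hom.vert_of_notMem _ _ _ hb]
      simp only [Box.Hom.comp, Box.Hom.vert_dir]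
  · have h : ¬ ∃ a, (φ.comp ψ).dir a = i := fun ⟨a, ha⟩ => hi ⟨φ.dir a, ha⟩
    rw [Box.Hom.vert_of_notMem _ _ _ h, Box.Hom.vert_of_notMem _ _ _ hi]
    simp only [Box.Hom.comp, Box.Hom.vert_of_notMem _ _ _ hi]

instance Box.category : Category Box where
  Hom := Box.Hom
  id := Box.Hom.refl
  comp := Box.Hom.comp
  id_comp := by
    intro m n φ
    refine Box.Hom.ext rfl ?_
    funext i
    by_cases hi : ∃ b, φ.dir b = i
    · obtain ⟨b, rfl⟩ := hi
      simp [Box.Hom.comp, Box.Hom.refl, Box.Hom.vert_dir]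
    · simp [Box.Hom.comp, Box.Hom.vert_of_notMem _ _ _ hi]
  comp_id := by
    intro m n φ
    exact Box.Hom.ext rfl (Box.Hom.vert_refl φ.shift)
  assoc := by
    intro k l m n φ ψ χ
    exact Box.Hom.ext rfl (Box.Hom.vert_comp ψ χ φ.shift).symm

/-- The standard `n`-cube as an object of the category of standard cubes. -/
abbrev Box.std (n : ℕ) : Box := ⟨n⟩

/-- The vertex `(0,…,0)` of the standard `n`-cube. -/
def Box.corner (n : ℕ) : Box.std 0 ⟶ Box.std n :=
  Box.Hom.mk ⟨Fin.elim0, fun a => a.elim0⟩ 0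

/-- The edge of the standard `n`-cube that leaves `(0,…,0)` in the direction `i`. -/
def Box.cornerEdge (n : ℕ) (i : Fin n) : Box.std 1 ⟶ Box.std n :=
  Box.Hom.mk ⟨fun _ => i, fun _ _ _ => Subsingleton.elim (α := Fin 1) _ _⟩ 0

/-- Complexes of cubes glued along isometries of faces, where a cube may also be glued to itself by
a nontrivial isometry (as in the quotient of a cube complex by a group that inverts edges).
Morphisms are the cubical maps: they send `n`-cubes isometrically to `n`-cubes. -/
abbrev CubeSet : Type 1 := Boxᵒᵖ ⥤ Type

namespace CubeSet

/-- The parametrized `n`-cubes of `X`.  Parametrized `1`-cubes are oriented edges. -/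
abbrev Cubes (X : CubeSet) (n : ℕ) : Type := X.obj (op (Box.std n))

/-- Restriction of a parametrized cube along a face isometry. -/
def face (X : CubeSet) {m n : ℕ} (φ : Box.std m ⟶ Box.std n) (c : X.Cubes n) : X.Cubes m :=
  X.map φ.op c

/-- The image of a parametrized cube under a cubical map. -/
def onCubes {X Y : CubeSet} (f : X ⟶ Y) {n : ℕ} (c : X.Cubes n) : Y.Cubes n :=
  f.app (op (Box.std n)) c

/-- The vertex of a parametrized cube at the corner `(0,…,0)`; for an oriented edge this is its
initial vertex. -/
def start (X : CubeSet) {n : ℕ} (c : X.Cubes n) : X.Cubes 0 := X.face (Box.corner n) c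

/-- The edge of a parametrized cube that leaves the corner `(0,…,0)` in the direction `i`. -/
def cornerEdge (X : CubeSet) {n : ℕ} (c : X.Cubes n) (i : Fin n) : X.Cubes 1 :=
  X.face (Box.cornerEdge n i) c

/-- `X` is a genuine cube complex: no cube is glued to itself by a nontrivial isometry. -/
def IsCubeComplex (X : CubeSet) : Prop :=
  ∀ (n : ℕ) (c : X.Cubes n) (σ : Box.std n ⟶ Box.std n), X.face σ c = c → σ = 𝟙 _

/-- The edges `e 0, …, e (n-1)`, seen as vertices of the link of their common initial vertex, span
a simplex of that link: they are the edges at one corner of an `n`-cube. -/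
def Spans (X : CubeSet) {n : ℕ} (e : Fin n → X.Cubes 1) : Prop :=
  ∃ c : X.Cubes n, ∀ i, X.cornerEdge c i = e i

/-- All induced maps of links are injective.  (The simplices of the link of `v` are the cubes with
a chosen corner at `v`.) -/
def IsImmersion {X Y : CubeSet} (f : X ⟶ Y) : Prop :=
  ∀ (n : ℕ) (c₁ c₂ : X.Cubes n), X.start c₁ = X.start c₂ → onCubes f c₁ = onCubes f c₂ → c₁ = c₂

/-- The image of each induced map of links `lk_X(v) → lk_Y(f(v))` is a full subcomplex: a simplex
of the link of `f(v)` all of whose vertices lie in the image belongs to the image. -/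
def HasFullLinks {X Y : CubeSet} (f : X ⟶ Y) : Prop :=
  ∀ (n : ℕ) (v : X.Cubes 0) (d : Y.Cubes n), Y.start d = onCubes f v →
    (∀ i, ∃ e : X.Cubes 1, X.start e = v ∧ onCubes f e = Y.cornerEdge d i) →
      ∃ c : X.Cubes n, X.start c = v ∧ onCubes f c = d

/-- Local isometries: immersions whose induced maps of links have full image. -/
def IsLocalIsometry {X Y : CubeSet} (f : X ⟶ Y) : Prop := IsImmersion f ∧ HasFullLinks f

/-! ### Elementary moves -/

/-- `g : A ⟶ B` is the quotient of `A` that identifies the parametrized cubes `c₁` and `c₂`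
(the coequalizer of the two cubes). -/
def IsIdentification {A B : CubeSet} (g : A ⟶ B) {n : ℕ} (c₁ c₂ : A.Cubes n) : Prop :=
  onCubes g c₁ = onCubes g c₂ ∧
    ∀ (Z : CubeSet) (h : A ⟶ Z), onCubes h c₁ = onCubes h c₂ → ∃! k : B ⟶ Z, g ≫ k = h

/-- `g : A ⟶ B` is obtained by attaching one cube at each of the sets of edges that satisfy `P`.
Here `P` is a property of tuples of oriented edges with a common initial vertex; each set of edges
that satisfies `P` is listed once, as a tuple `e i`, and the cube `b i` is glued to `A` exactly
along the edges at one of its corners (`B` is the pushout). -/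
def IsAttachment {A B : CubeSet} (g : A ⟶ B) (P : ∀ n : ℕ, (Fin n → A.Cubes 1) → Prop) : Prop :=
  ∃ (I : Type) (dim : I → ℕ) (e : ∀ i, Fin (dim i) → A.Cubes 1) (b : ∀ i, B.Cubes (dim i)),
    (∀ i, P (dim i) (e i)) ∧
    (∀ (n : ℕ) (e' : Fin n → A.Cubes 1), P n e' → ∃! i, Set.range (e i) = Set.range e') ∧
    (∀ i j, B.cornerEdge (b i) j = onCubes g (e i j)) ∧
    ∀ (Z : CubeSet) (h : A ⟶ Z) (z : ∀ i, Z.Cubes (dim i)),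
      (∀ i j, Z.cornerEdge (z i) j = onCubes h (e i j)) →
        ∃! k : B ⟶ Z, g ≫ k = h ∧ ∀ i, onCubes k (b i) = z i

end CubeSet

open CubeSet

/-! ### The cubical completion of a cubical map `f : A ⟶ Y`

The complexes being modified are objects of `Over Y`, that is, complexes with a cubical map to
`Y`. -/

namespace Cubical

/-- Two distinct oriented edges with a common initial vertex and the same image in `Y`. -/
def IsFoldPair {Y : CubeSet} (A : Over Y) (e₁ e₂ : A.left.Cubes 1) : Prop :=
  e₁ ≠ e₂ ∧ A.left.start e₁ = A.left.start e₂ ∧ onCubes A.hom e₁ = onCubes A.hom e₂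

/-- Folding: identifying two edges with a common initial vertex and the same image. -/
def fold (Y : CubeSet) : MorphismProperty (Over Y) := fun A _ g =>
  ∃ e₁ e₂ : A.left.Cubes 1, IsFoldPair A e₁ e₂ ∧ IsIdentification g.left e₁ e₂

/-- Two distinct cubes, of dimension at least `2`, with the same `1`-skeleton. -/
def IsParallelPair {Y : CubeSet} (A : Over Y) {n : ℕ} (c₁ c₂ : A.left.Cubes n) : Prop :=
  2 ≤ n ∧ c₁ ≠ c₂ ∧ ∀ φ : Box.std 1 ⟶ Box.std n, A.left.face φ c₁ = A.left.face φ c₂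

/-- Cube identification: identifying two cubes with the same `1`-skeleton. -/
def cubeIdentification (Y : CubeSet) : MorphismProperty (Over Y) := fun A _ g =>
  ∃ (n : ℕ) (c₁ c₂ : A.left.Cubes n), IsParallelPair A c₁ c₂ ∧ IsIdentification g.left c₁ c₂

/-- A set of at least two vertices of the link of a vertex of `A` whose images in the link of its
image span a simplex, but which do not themselves span a simplex. -/
def IsMissingCorner {Y : CubeSet} (A : Over Y) (n : ℕ) (e : Fin n → A.left.Cubes 1) : Prop :=
  2 ≤ n ∧ Function.Injective e ∧ (∀ i j, A.left.start (e i) = A.left.start (e j)) ∧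
    Y.Spans (fun i => onCubes A.hom (e i)) ∧ ¬ A.left.Spans e

/-- Performing all possible cube attachments. -/
def cubeAttachment (Y : CubeSet) : MorphismProperty (Over Y) := fun A _ g =>
  IsAttachment g.left (IsMissingCorner A)

/-- One round of the procedure: folds until no fold is possible, then cube identifications until no
cube identification is possible, then all possible cube attachments. -/
def completionRound (Y : CubeSet) : MorphismProperty (Over Y) := fun A D g =>
  ∃ (B C : Over Y) (p : A ⟶ B) (q : B ⟶ C) (r : C ⟶ D), g = p ≫ q ≫ r ∧
    (fold Y).multiplicativeClosure p ∧ (∀ e₁ e₂, ¬ IsFoldPair B e₁ e₂) ∧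
    (cubeIdentification Y).multiplicativeClosure q ∧
      (∀ (n : ℕ) (c₁ c₂ : C.left.Cubes n), ¬ IsParallelPair C c₁ c₂) ∧
    cubeAttachment Y r

/-- `ι : A ⟶ Z` is a standard completion of `A` over `Y`: the direct limit of a sequence
`A = A₀ ⟶ A₁ ⟶ A₂ ⟶ ⋯` in which each map is one round of the procedure. -/
def IsStandardCompletion {Y : CubeSet} {A Z : Over Y} (ι : A ⟶ Z) : Prop :=
  (completionRound Y).transfiniteCompositionsOfShape ℕ ι

end Cubical

/-! ### Completions of labeled complexes -/

/-- A `Γ`-labeled complex: each (unoriented) edge is labeled by a vertex of `Γ` such that in each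
square parallel edges have the same label and the labels of adjacent edges are adjacent in `Γ`. -/
structure LabeledComplex {V : Type} (Γ : SimpleGraph V) where
  complex : CubeSet
  label : complex.Cubes 1 → V
  label_reparam : ∀ (e : complex.Cubes 1) (σ : Box.std 1 ⟶ Box.std 1),
    label (complex.face σ e) = label e
  label_parallel : ∀ (c : complex.Cubes 2) (φ ψ : Box.std 1 ⟶ Box.std 2),
    Box.Hom.dir φ 0 = Box.Hom.dir ψ 0 → label (complex.face φ c) = label (complex.face ψ c)
  label_adj : ∀ (c : complex.Cubes 2) (φ ψ : Box.std 1 ⟶ Box.std 2),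
    Box.Hom.dir φ 0 ≠ Box.Hom.dir ψ 0 → Γ.Adj (label (complex.face φ c)) (label (complex.face ψ c))

namespace LabeledComplex

variable {V : Type} {Γ : SimpleGraph V}

/-- Label-preserving cubical maps. -/
@[ext]
structure Hom (A B : LabeledComplex Γ) where
  toMap : A.complex ⟶ B.complex
  label_eq : ∀ e : A.complex.Cubes 1, B.label (onCubes toMap e) = A.label e

instance : Category (LabeledComplex Γ) where
  Hom := Hom
  id A := ⟨𝟙 A.complex, fun _ => rfl⟩
  comp f g := ⟨f.toMap ≫ g.toMap, fun e => by
    rw [← f.label_eq e, ← g.label_eq]; rfl⟩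
  id_comp f := Hom.ext (Category.id_comp f.toMap)
  comp_id f := Hom.ext (Category.comp_id f.toMap)
  assoc f g h := Hom.ext (Category.assoc f.toMap g.toMap h.toMap)

/-- The underlying cubical map of a map of labeled complexes. -/
def map {A B : LabeledComplex Γ} (g : A ⟶ B) : A.complex ⟶ B.complex := Hom.toMap g

/-- Two distinct edges with the same label and a common endpoint, oriented away from it. -/
def IsFoldPair (A : LabeledComplex Γ) (e₁ e₂ : A.complex.Cubes 1) : Prop :=
  (∀ σ : Box.std 1 ⟶ Box.std 1, A.complex.face σ e₁ ≠ e₂) ∧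
    A.complex.start e₁ = A.complex.start e₂ ∧ A.label e₁ = A.label e₂

/-- The fold operation: identifying two distinct edges with the same label at a common vertex. -/
def fold (Γ : SimpleGraph V) : MorphismProperty (LabeledComplex Γ) := fun A _ g =>
  ∃ e₁ e₂ : A.complex.Cubes 1, A.IsFoldPair e₁ e₂ ∧ IsIdentification (map g) e₁ e₂

/-- Two distinct cubes, of dimension at least `2`, with the same boundary. -/
def IsParallelPair (A : LabeledComplex Γ) {n : ℕ} (c₁ c₂ : A.complex.Cubes n) : Prop :=
  2 ≤ n ∧ (∀ σ : Box.std n ⟶ Box.std n, A.complex.face σ c₁ ≠ c₂) ∧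
    ∀ (m : ℕ), m < n → ∀ φ : Box.std m ⟶ Box.std n, A.complex.face φ c₁ = A.complex.face φ c₂

/-- The cube identification operation: identifying two distinct cubes with the same boundary. -/
def cubeIdentification (Γ : SimpleGraph V) : MorphismProperty (LabeledComplex Γ) := fun A _ g =>
  ∃ (n : ℕ) (c₁ c₂ : A.complex.Cubes n), A.IsParallelPair c₁ c₂ ∧
    IsIdentification (map g) c₁ c₂

/-- No fold and no cube identification operation can be performed. -/
def IsFolded (A : LabeledComplex Γ) : Prop :=
  (∀ e₁ e₂, ¬ A.IsFoldPair e₁ e₂) ∧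
    ∀ (n : ℕ) (c₁ c₂ : A.complex.Cubes n), ¬ A.IsParallelPair c₁ c₂

/-- At least two edges incident to a common vertex, whose labels are pairwise adjacent in `Γ`. -/
def IsCommutingCorner (A : LabeledComplex Γ) (n : ℕ) (e : Fin n → A.complex.Cubes 1) : Prop :=
  2 ≤ n ∧ (∀ i j, A.complex.start (e i) = A.complex.start (e j)) ∧
    Pairwise fun i j => Γ.Adj (A.label (e i)) (A.label (e j))

/-- Any edges at a common vertex with pairwise adjacent labels lie in a common cube, whose dimension
is their number. -/
def IsCubeFull (A : LabeledComplex Γ) : Prop :=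
  ∀ (n : ℕ) (e : Fin n → A.complex.Cubes 1), A.IsCommutingCorner n e → A.complex.Spans e

/-- Performing all cube attachment operations: one cube is attached at each set of edges at a common
vertex with pairwise adjacent labels that do not yet lie in a common cube. -/
def cubeAttachment (Γ : SimpleGraph V) : MorphismProperty (LabeledComplex Γ) := fun A _ g =>
  IsAttachment (map g) fun n e => A.IsCommutingCorner n e ∧ ¬ A.complex.Spans e

/-- One round of the standard procedure: fold and cube identification operations, in any order,
until the complex is folded, and then all possible cube attachments. -/
def completionRound (Γ : SimpleGraph V) : MorphismProperty (LabeledComplex Γ) := fun A C g =>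
  ∃ (B : LabeledComplex Γ) (p : A ⟶ B) (q : B ⟶ C), g = p ≫ q ∧
    (fold Γ ⊔ cubeIdentification Γ).multiplicativeClosure p ∧ B.IsFolded ∧ cubeAttachment Γ q

/-- `j : A ⟶ Ω` is a standard completion of the `Γ`-labeled complex `A`: the direct limit of a
sequence `A = A₀ ⟶ A₁ ⟶ A₂ ⟶ ⋯` in which each map is one round of the procedure. -/
def IsStandardCompletion {A Ω : LabeledComplex Γ} (j : A ⟶ Ω) : Prop :=
  (completionRound Γ).transfiniteCompositionsOfShape ℕ j

end LabeledComplex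

/-! ### Right-angled Coxeter groups and the Davis complex -/

section RightAngled

variable {V : Type} (Γ : SimpleGraph V)

open Classical in
/-- The Coxeter matrix of the right-angled Coxeter group with defining graph `Γ`: generators are
involutions, adjacent ones commute, and there are no other relations. -/
def racgMatrix : CoxeterMatrix V where
  M := Matrix.of fun u v => if u = v then 1 else if Γ.Adj u v then 2 else 0
  isSymm := by
    ext u v
    simp only [Matrix.transpose_apply, Matrix.of_apply, eq_comm (a := u), Γ.adj_comm u v]
  diagonal := by simp
  off_diagonal := by
    intro u v h
    simp only [Matrix.of_apply, h, if_false]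
    split_ifs <;> decide

variable {Γ} {G : Type} [Group G] (cs : CoxeterSystem (racgMatrix Γ) G)

/-- The parametrized `n`-cubes of the Davis complex of `G`, given by their vertices: the vertices of
the complex are the elements of `G`, and the cubes are the left cosets of the subgroups generated by
`n` pairwise commuting generators.  The edges in the direction `i` join `g` to `g * t i`. -/
@[ext]
structure DavisCube (n : ℕ) where
  vertex : (Fin n → ZMod 2) → G
  exists_labels : ∃ t : Fin n → V, (Pairwise fun i j => Γ.Adj (t i) (t j)) ∧
    ∀ x i, vertex (x + Pi.single i 1) = vertex x * cs.simple (t i)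

/-- Restriction of a cube of the Davis complex to a face. -/
def DavisCube.face {m n : Box} (φ : m ⟶ n) (c : DavisCube cs n.dim) : DavisCube cs m.dim where
  vertex x := c.vertex (Box.Hom.vert φ x)
  exists_labels := by
    obtain ⟨t, ht, hc⟩ := c.exists_labels
    refine ⟨fun a => t (Box.Hom.dir φ a), fun a b hab => ht ?_, fun x a => ?_⟩
    · exact fun h => hab ((Box.Hom.dir φ).injective h)
    · rw [Box.Hom.vert_add_single, hc]

theorem DavisCube.face_id {n : Box} (c : DavisCube cs n.dim) : DavisCube.face cs (𝟙 n) c = c :=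
  DavisCube.ext (funext fun x => congrArg c.vertex (Box.Hom.vert_refl x))

theorem DavisCube.face_comp {l m n : Box} (φ : l ⟶ m) (ψ : m ⟶ n) (c : DavisCube cs n.dim) :
    DavisCube.face cs (φ ≫ ψ) c = DavisCube.face cs φ (DavisCube.face cs ψ c) :=
  DavisCube.ext (funext fun x => congrArg c.vertex (Box.Hom.vert_comp φ ψ x))

/-- The Davis complex of the right-angled Coxeter group `G`. -/
def davisComplex : CubeSet where
  obj n := DavisCube cs n.unop.dim
  map φ := TypeCat.ofHom (DavisCube.face cs φ.unop)
  map_id _ := ConcreteCategory.hom_ext _ _ fun c => DavisCube.face_id cs c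
  map_comp φ ψ := ConcreteCategory.hom_ext _ _ fun c => DavisCube.face_comp cs ψ.unop φ.unop c

/-- Two cubes of the Davis complex are equivalent if they differ by left multiplication by an
element of `G`. -/
def davisSetoid (n : ℕ) : Setoid (DavisCube cs n) where
  r c d := ∃ g : G, ∀ x, d.vertex x = g * c.vertex x
  iseqv :=
    { refl := fun c => ⟨1, fun x => (one_mul _).symm⟩
      symm := by
        rintro c d ⟨g, h⟩
        exact ⟨g⁻¹, fun x => by rw [h x, inv_mul_cancel_left]⟩
      trans := by
        rintro c d e ⟨g, h⟩ ⟨g', h'⟩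
        exact ⟨g' * g, fun x => by rw [h' x, h x, mul_assoc]⟩ }

/-- The quotient `Y` of the Davis complex by the action of `G`.  The action is free on vertices, so
the link of the vertex of `Y` is the link of a vertex of the Davis complex. -/
def davisQuotient : CubeSet where
  obj n := Quotient (davisSetoid cs n.unop.dim)
  map φ := TypeCat.ofHom (Quotient.map (DavisCube.face cs φ.unop) fun _ _ ⟨g, h⟩ =>
    ⟨g, fun x => h (Box.Hom.vert φ.unop x)⟩)
  map_id _ := ConcreteCategory.hom_ext _ _ fun c => by
    obtain ⟨c, rfl⟩ := Quotient.exists_rep c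
    exact congrArg (Quotient.mk _) (DavisCube.face_id cs c)
  map_comp φ ψ := ConcreteCategory.hom_ext _ _ fun c => by
    obtain ⟨c, rfl⟩ := Quotient.exists_rep c
    exact congrArg (Quotient.mk _) (DavisCube.face_comp cs ψ.unop φ.unop c)

/-- The vertex `1` of the Davis complex. -/
def davisVertex : DavisCube cs 0 where
  vertex _ := 1
  exists_labels := ⟨Fin.elim0, fun i => i.elim0, fun _ i => i.elim0⟩

/-- The oriented edge of the Davis complex from `1` to the generator `s`. -/
def davisEdge (s : V) : DavisCube cs 1 where
  vertex x := if x 0 = 0 then 1 else cs.simple s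
  exists_labels := by
    refine ⟨fun _ => s, fun i j hij => absurd (Subsingleton.elim i j) hij, fun x i => ?_⟩
    obtain rfl : i = 0 := Subsingleton.elim _ _
    have h : ∀ y : ZMod 2, y = 0 ∨ y = 1 := by decide
    have h11 : (1 : ZMod 2) + 1 = 0 := by decide
    rcases h (x 0) with h0 | h0 <;> simp [h0, h11]

/-- The oriented edge of `Y` labeled by the generator `s`. -/
def davisQuotientEdge (s : V) : (davisQuotient cs).Cubes 1 :=
  Quotient.mk (davisSetoid cs 1) (davisEdge cs s)

/-! ### Bouquets of circles -/

/-- The parametrized cubes of a graph with vertex set `P` and edge set `E`. -/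
inductive GraphCube (P E : Type) : ℕ → Type
  | vertex (x : P) : GraphCube P E 0
  | edge (a : E) (ε : ZMod 2) : GraphCube P E 1

/-- Restriction of cubes of a graph; `bd a 0` and `bd a 1` are the endpoints of the edge `a`, and
`edge a 0`, `edge a 1` are its two orientations, starting at `bd a 0` and `bd a 1`. -/
def GraphCube.face {P E : Type} (bd : E → ZMod 2 → P) :
    ∀ {m n : ℕ}, Box.Hom (Box.std m) (Box.std n) → GraphCube P E n → GraphCube P E m
  | 0, _, _, .vertex x => .vertex x
  | 0, _, φ, .edge a ε => .vertex (bd a (ε + φ.shift (0 : Fin 1)))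
  | 1, _, φ, .edge a ε => .edge a (ε + φ.shift (0 : Fin 1))
  | _ + 1, _, φ, .vertex _ => (φ.dir (0 : Fin (_ + 1))).elim0
  | _ + 2, _, φ, .edge _ _ =>
      absurd (φ.dir.injective (Subsingleton.elim (α := Fin 1) (φ.dir (0 : Fin (_ + 2))) (φ.dir 1)))
        (by simp)

theorem GraphCube.face_id {P E : Type} (bd : E → ZMod 2 → P) :
    ∀ {n : ℕ} (c : GraphCube P E n), GraphCube.face bd (Box.Hom.refl (Box.std n)) c = c
  | _, .vertex _ => rfl
  | _, .edge a ε => congrArg (GraphCube.edge a) (add_zero ε)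

theorem GraphCube.face_comp {P E : Type} (bd : E → ZMod 2 → P) :
    ∀ {l m n : ℕ} (φ : Box.Hom (Box.std l) (Box.std m)) (ψ : Box.Hom (Box.std m) (Box.std n))
      (c : GraphCube P E n),
      GraphCube.face bd (φ.comp ψ) c = GraphCube.face bd φ (GraphCube.face bd ψ c)
  | 0, 0, _, _, _, .vertex _ => rfl
  | 0, 0, _, φ, ψ, .edge a ε => by
      have h : ψ.vert φ.shift (0 : Fin 1) = ψ.shift (0 : Fin 1) :=
        Box.Hom.vert_of_notMem ψ _ _ fun ⟨b, _⟩ => Fin.elim0 b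
      simp only [GraphCube.face, Box.Hom.comp, h]
  | 0, 1, _, φ, ψ, .edge a ε => by
      have h : ψ.vert φ.shift (0 : Fin 1) = ψ.shift (0 : Fin 1) + φ.shift (0 : Fin 1) := by
        have h0 : ψ.dir (0 : Fin 1) = (0 : Fin 1) := Subsingleton.elim (α := Fin 1) _ _
        have := Box.Hom.vert_dir ψ φ.shift (0 : Fin 1)
        rwa [h0] at this
      simp only [GraphCube.face, Box.Hom.comp, h, add_assoc]
  | 1, 1, _, φ, ψ, .edge a ε => by
      have h : ψ.vert φ.shift (0 : Fin 1) = ψ.shift (0 : Fin 1) + φ.shift (0 : Fin 1) := by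
        have h0 : ψ.dir (0 : Fin 1) = (0 : Fin 1) := Subsingleton.elim (α := Fin 1) _ _
        have := Box.Hom.vert_dir ψ φ.shift (0 : Fin 1)
        rwa [h0] at this
      simp only [GraphCube.face, Box.Hom.comp, h, add_assoc]
  | l + 1, 0, _, φ, _, _ => (φ.dir (0 : Fin (l + 1))).elim0
  | l + 2, 1, _, φ, _, _ =>
      absurd (φ.dir.injective (Subsingleton.elim (α := Fin 1) (φ.dir (0 : Fin (l + 2))) (φ.dir 1)))
        (by simp)
  | _, m + 1, _, _, ψ, .vertex _ => (ψ.dir (0 : Fin (m + 1))).elim0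
  | _, m + 2, _, _, ψ, .edge _ _ =>
      absurd (ψ.dir.injective (Subsingleton.elim (α := Fin 1) (ψ.dir (0 : Fin (m + 2))) (ψ.dir 1)))
        (by simp)

/-- The graph with vertex set `P`, edge set `E` and endpoints `bd`, as a one-dimensional cube
complex. -/
def graphComplex {P E : Type} (bd : E → ZMod 2 → P) : CubeSet where
  obj n := GraphCube P E n.unop.dim
  map φ := TypeCat.ofHom (GraphCube.face bd φ.unop)
  map_id _ := ConcreteCategory.hom_ext _ _ fun c => GraphCube.face_id bd c
  map_comp φ ψ := ConcreteCategory.hom_ext _ _ fun c => GraphCube.face_comp bd ψ.unop φ.unop c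

/-- The edges of the subdivided bouquet of circles: the `i`-th circle has one edge for each letter of
the word `w i`. -/
abbrev BouquetEdge {k : ℕ} (w : Fin k → List V) : Type := Σ i : Fin k, Fin (w i).length

/-- The vertices of the subdivided bouquet: the base point `none`, and the initial points of those
edges that are not the first one of their circle. -/
abbrev BouquetVertex {k : ℕ} (w : Fin k → List V) : Type :=
  Option {a : BouquetEdge w // (a.2 : ℕ) ≠ 0}

/-- The `l`-th point of the `i`-th circle; the points `0` and `(w i).length` are the base point. -/
def bouquetPoint {k : ℕ} (w : Fin k → List V) (i : Fin k) (l : ℕ) : BouquetVertex w :=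
  if h : l ≠ 0 ∧ l < (w i).length then some ⟨⟨i, l, h.2⟩, h.1⟩ else none

/-- The endpoints of an edge of the bouquet. -/
def bouquetBoundary {k : ℕ} (w : Fin k → List V) (a : BouquetEdge w) (ε : ZMod 2) :
    BouquetVertex w :=
  bouquetPoint w a.1 (if ε = 0 then (a.2 : ℕ) else (a.2 : ℕ) + 1)

/-- The letter on an edge of the bouquet. -/
def bouquetLetter {k : ℕ} (w : Fin k → List V) (a : BouquetEdge w) : V := (w a.1).get a.2

/-- The bouquet of circles, one for each word `w i`, subdivided into as many edges as the word has
letters. -/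
def bouquet {k : ℕ} (w : Fin k → List V) : CubeSet := graphComplex (bouquetBoundary w)

/-- The label of an oriented edge of the bouquet. -/
def bouquetLabel {k : ℕ} (w : Fin k → List V) :
    GraphCube (BouquetVertex w) (BouquetEdge w) 1 → V
  | .edge a _ => bouquetLetter w a

/-- The bouquet as a `Γ`-labeled complex. -/
def labeledBouquet (Γ : SimpleGraph V) {k : ℕ} (w : Fin k → List V) : LabeledComplex Γ where
  complex := bouquet w
  label := bouquetLabel w
  label_reparam e _ := match e with
    | .edge _ _ => rfl
  label_parallel c := nomatch c
  label_adj c := nomatch c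

/-- The cubical map from the bouquet to `Y` that reads the word `w i` along the `i`-th circle. -/
def bouquetCube {k : ℕ} (w : Fin k → List V) :
    ∀ {n : ℕ}, GraphCube (BouquetVertex w) (BouquetEdge w) n → (davisQuotient cs).Cubes n
  | _, .vertex _ => Quotient.mk (davisSetoid cs 0) (davisVertex cs)
  | _, .edge a _ => davisQuotientEdge cs (bouquetLetter w a)

theorem bouquetCube_face {k : ℕ} (w : Fin k → List V) :
    ∀ {m n : ℕ} (φ : Box.std m ⟶ Box.std n) (c : GraphCube (BouquetVertex w) (BouquetEdge w) n),
      bouquetCube cs w (GraphCube.face (bouquetBoundary w) φ c) =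
        (davisQuotient cs).face φ (bouquetCube cs w c)
  | 0, _, _, .vertex _ => Quotient.sound ⟨1, fun _ => (one_mul _).symm⟩
  | 0, _, φ, .edge a _ => by
      refine Quotient.sound ⟨(davisEdge cs (bouquetLetter w a)).vertex (Box.Hom.vert φ 0),
        fun x => ?_⟩
      rw [Subsingleton.elim x 0]
      exact (mul_one _).symm
  | 1, _, φ, .edge a _ => by
      have h0 : Box.Hom.dir φ (0 : Fin 1) = (0 : Fin 1) := Subsingleton.elim (α := Fin 1) _ _
      have hv : ∀ x, Box.Hom.vert φ x (0 : Fin 1) = Box.Hom.shift φ (0 : Fin 1) + x (0 : Fin 1) := by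
        intro x
        have := Box.Hom.vert_dir φ x (0 : Fin 1)
        rwa [h0] at this
      have hz : ∀ y : ZMod 2, y = 0 ∨ y = 1 := by decide
      have h11 : (1 : ZMod 2) + 1 = 0 := by decide
      refine Quotient.sound ⟨if Box.Hom.shift φ (0 : Fin 1) = 0 then 1
        else cs.simple (bouquetLetter w a), fun x => ?_⟩
      change (if Box.Hom.vert φ x (0 : Fin 1) = 0 then 1 else cs.simple (bouquetLetter w a)) =
        _ * (if x (0 : Fin 1) = 0 then 1 else cs.simple (bouquetLetter w a))
      rw [hv x]
      rcases hz (Box.Hom.shift φ (0 : Fin 1)) with hs | hs <;>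
        rcases hz (x (0 : Fin 1)) with hx | hx <;> simp [hs, hx, h11]
  | l + 1, _, φ, .vertex _ => (Box.Hom.dir φ (0 : Fin (l + 1))).elim0
  | l + 2, _, φ, .edge _ _ =>
      absurd ((Box.Hom.dir φ).injective (Subsingleton.elim (α := Fin 1)
        (Box.Hom.dir φ (0 : Fin (l + 2))) (Box.Hom.dir φ (1 : Fin (l + 2))))) (by simp)

/-- The bouquet with its cubical map to `Y`. -/
def bouquetOver {k : ℕ} (w : Fin k → List V) : Over (davisQuotient cs) :=
  Over.mk (Y := bouquet w)
    { app := fun n => TypeCat.ofHom (bouquetCube cs w (n := n.unop.dim))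
      naturality := fun _ _ φ => ConcreteCategory.hom_ext _ _ fun c =>
        bouquetCube_face cs w φ.unop c }

end RightAngled

end

/-!
A cube of `Y` is the same thing as a tuple of pairwise adjacent vertices of `Γ`
(`davisQuotient_ext`, `exists_davisLabels_eq`), so a labeling by `Γ` is the same thing as a
cubical map to `Y`: the functor `LabeledComplex.toOver` is an equivalence. Both procedures
therefore take place among the complexes over `Y`, and both results turn out to be the initial
local isometry to `Y` under the bouquet.

Every move is orthogonal to local isometries `W → Y`: a map from the complex before the move to
`W` extends uniquely to the complex after the move (`isLocal_of_isIdentification`,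
`isLocal_of_isAttachment`). Orthogonality passes to sequential direct limits. On the other hand,
one round identifies any two cubes with a common corner and the same image in `Y`, and it fills
every corner whose image in `Y` spans a cube. In a direct limit, finitely many cubes with a common
corner already have a common corner in one of the complexes of the sequence (`exists_stage`), so
the limit is itself a local isometry to `Y` (`isLocalIsometry_of_completionSteps`). Two local
isometries to `Y` that receive orthogonal maps from the same complex are uniquely isomorphic under
it.

The labeled procedure never identifies an edge or a cube with a reparametrization of itself,
whereas immersions to `Y` do not allow a cube and a different reparametrization of it to have a
common corner and the same image. That such a pair does not occur is where torsion-freeness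
enters. The quotient `H \ Ỹ` of the Davis complex is a covering of `Y`, hence a local isometry,
and it is a genuine cube complex because `H` is torsion-free (`davisCover_isCubeComplex`). The
words `w i` represent elements of `H`, so the bouquet maps to `H \ Ỹ`; by orthogonality so do all
complexes of both sequences and their limits (`LabeledComplex.IsFolded.isImmersion`). A complex
that maps to a genuine cube complex is one itself.

For existence, identifications and attachments are constructed as quotients of presheaves. All
complexes reached in finitely many rounds have finitely many cubes, of dimension at most the
number of vertices of `Γ`, and each identification decreases the number of cubes, so each round
ends.
-/

noncomputable section

/-! ### Faces of standard cubes -/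

namespace Box

/-- The vertex `x` of the standard `n`-cube. -/
def vertex {n : ℕ} (x : Fin n → ZMod 2) : Box.std 0 ⟶ Box.std n :=
  Box.Hom.mk ⟨Fin.elim0, fun a => a.elim0⟩ x

/-- The edge of the standard `n`-cube that leaves the vertex `x` in the direction `i`. -/
def edge {n : ℕ} (i : Fin n) (x : Fin n → ZMod 2) : Box.std 1 ⟶ Box.std n :=
  Box.Hom.mk ⟨fun _ => i, fun _ _ _ => Subsingleton.elim (α := Fin 1) _ _⟩ x

/-- The square of the standard `n`-cube that leaves the vertex `x` in the directions `i` and `j`. -/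
def square {n : ℕ} {i j : Fin n} (h : i ≠ j) (x : Fin n → ZMod 2) : Box.std 2 ⟶ Box.std n :=
  Box.Hom.mk ⟨![i, j], by
    intro a b hab
    fin_cases a <;> fin_cases b <;> first | rfl | exact absurd hab h | exact absurd hab.symm h⟩ x

/-- The automorphism of the standard `n`-cube that permutes the coordinates by `σ`. -/
def permute {n : ℕ} (σ : Equiv.Perm (Fin n)) : Box.std n ⟶ Box.std n :=
  Box.Hom.mk σ.toEmbedding 0

theorem hom_ext {m n : ℕ} {φ ψ : Box.std m ⟶ Box.std n} (hd : ∀ a, Hom.dir φ a = Hom.dir ψ a)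
    (hs : Hom.shift φ = Hom.shift ψ) : φ = ψ :=
  Hom.ext (Function.Embedding.ext hd) hs

theorem vert_zero {m n : ℕ} (φ : Box.std m ⟶ Box.std n) : Hom.vert φ 0 = Hom.shift φ := by
  funext i
  by_cases hi : ∃ a, Hom.dir φ a = i
  · obtain ⟨a, rfl⟩ := hi
    exact (Hom.vert_dir φ 0 a).trans (add_zero _)
  · simp [Hom.vert_of_notMem _ _ _ hi]

theorem corner_eq (n : ℕ) : corner n = vertex 0 := rfl

theorem cornerEdge_eq (n : ℕ) (i : Fin n) : cornerEdge n i = edge i 0 := rfl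

theorem eq_edge {n : ℕ} (φ : Box.std 1 ⟶ Box.std n) : φ = edge (Hom.dir φ 0) (Hom.shift φ) :=
  hom_ext (fun a => by rw [Subsingleton.elim (α := Fin 1) a 0]; rfl) rfl

theorem vertex_comp {m n : ℕ} (x : Fin m → ZMod 2) (φ : Box.std m ⟶ Box.std n) :
    vertex x ≫ φ = vertex (Hom.vert φ x) :=
  hom_ext (fun a => a.elim0) rfl

theorem edge_comp {m n : ℕ} (i : Fin m) (x : Fin m → ZMod 2) (φ : Box.std m ⟶ Box.std n) :
    edge i x ≫ φ = edge (Hom.dir φ i) (Hom.vert φ x) :=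
  hom_ext (fun _ => rfl) rfl

theorem corner_comp {m n : ℕ} (φ : Box.std m ⟶ Box.std n) :
    corner m ≫ φ = vertex (Hom.shift φ) := by
  rw [corner_eq, vertex_comp, vert_zero]

theorem cornerEdge_comp {m n : ℕ} (i : Fin m) (φ : Box.std m ⟶ Box.std n) :
    cornerEdge m i ≫ φ = edge (Hom.dir φ i) (Hom.shift φ) := by
  rw [cornerEdge_eq, edge_comp, vert_zero]

theorem corner_comp_edge {n : ℕ} (i : Fin n) (x : Fin n → ZMod 2) :
    corner 1 ≫ edge i x = vertex x := corner_comp _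

theorem vertex_comp_edge {n : ℕ} (i : Fin n) (x : Fin n → ZMod 2) :
    vertex (Pi.single 0 1) ≫ edge i x = vertex (x + Pi.single i 1) := by
  have h := Hom.vert_add_single (edge i x) 0 (0 : Fin 1)
  rw [zero_add, vert_zero] at h
  rw [vertex_comp, h]
  rfl

theorem corner_zero : corner 0 = 𝟙 (Box.std 0) :=
  hom_ext (fun a => a.elim0) (funext fun a => a.elim0)

theorem cornerEdge_one (i : Fin 1) : cornerEdge 1 i = 𝟙 (Box.std 1) :=
  hom_ext (fun _ => Subsingleton.elim (α := Fin 1) _ _) rfl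

theorem cornerEdge_comp_permute {n : ℕ} (i : Fin n) (σ : Equiv.Perm (Fin n)) :
    cornerEdge n i ≫ permute σ = cornerEdge n (σ i) :=
  cornerEdge_comp _ _

/-- The one-skeleton of a cube is connected. -/
theorem vertex_induction {n : ℕ} {p : (Fin n → ZMod 2) → Prop} (h0 : p 0)
    (h : ∀ x i, p x → p (x + Pi.single i 1)) (x : Fin n → ZMod 2) : p x := by
  have hz : ∀ y : ZMod 2, y = 0 ∨ y = 1 := by decide
  have key : ∀ s : Finset (Fin n), p (∑ i ∈ s, Pi.single i (x i)) := by
    intro s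
    induction s using Finset.induction_on with
    | empty => simpa using h0
    | insert a s ha ih =>
      rw [Finset.sum_insert ha, add_comm]
      rcases hz (x a) with hx | hx
      · simpa [hx] using ih
      · rw [hx]; exact h _ _ ih
  have := key Finset.univ
  rwa [Finset.univ_sum_single] at this

/-- A function on the vertices of a cube that is constant along edges is constant. -/
theorem eq_of_edge_invariant {n : ℕ} {α : Type*} {f : (Fin n → ZMod 2) → α}
    (h : ∀ x i, f (x + Pi.single i 1) = f x) (x : Fin n → ZMod 2) : f x = f 0 :=
  vertex_induction (p := fun x => f x = f 0) rfl (fun x i hx => (h x i).trans hx) x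

instance (m n : Box) : Finite (m ⟶ n) :=
  Finite.of_injective (fun φ => (Hom.dir φ, Hom.shift φ)) fun _ _ h =>
    Hom.ext (congrArg Prod.fst h) (congrArg Prod.snd h)

end Box

/-! ### Cubes and cubical maps -/

namespace CubeSet

variable {X Y Z : CubeSet}

theorem face_id {n : ℕ} (c : X.Cubes n) : X.face (𝟙 _) c = c := by
  simp [face]

theorem face_comp {l m n : ℕ} (φ : Box.std l ⟶ Box.std m) (ψ : Box.std m ⟶ Box.std n)
    (c : X.Cubes n) : X.face (φ ≫ ψ) c = X.face φ (X.face ψ c) := by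
  simp [face]

theorem onCubes_face (f : X ⟶ Y) {m n : ℕ} (φ : Box.std m ⟶ Box.std n) (c : X.Cubes n) :
    onCubes f (X.face φ c) = Y.face φ (onCubes f c) :=
  NatTrans.naturality_apply f φ.op c

theorem onCubes_comp (f : X ⟶ Y) (g : Y ⟶ Z) {n : ℕ} (c : X.Cubes n) :
    onCubes (f ≫ g) c = onCubes g (onCubes f c) := rfl

theorem onCubes_start (f : X ⟶ Y) {n : ℕ} (c : X.Cubes n) :
    onCubes f (X.start c) = Y.start (onCubes f c) := onCubes_face f _ c

theorem start_onCubes_eq (f : X ⟶ Y) {m n : ℕ} {c : X.Cubes m} {d : X.Cubes n}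
    (h : X.start c = X.start d) : Y.start (onCubes f c) = Y.start (onCubes f d) := by
  rw [← onCubes_start, ← onCubes_start, h]

theorem onCubes_cornerEdge (f : X ⟶ Y) {n : ℕ} (c : X.Cubes n) (i : Fin n) :
    onCubes f (X.cornerEdge c i) = Y.cornerEdge (onCubes f c) i := onCubes_face f _ c

theorem hom_ext {f g : X ⟶ Y} (h : ∀ (n : ℕ) (c : X.Cubes n), onCubes f c = onCubes g c) :
    f = g :=
  NatTrans.ext (funext fun n => ConcreteCategory.hom_ext _ _ fun c => h n.unop.dim c)

/-- A cubical map from its effect on parametrized cubes. -/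
def homMk (f : ∀ n, X.Cubes n → Y.Cubes n)
    (hf : ∀ {m n : ℕ} (φ : Box.std m ⟶ Box.std n) (c : X.Cubes n),
      f m (X.face φ c) = Y.face φ (f n c)) : X ⟶ Y where
  app n := TypeCat.ofHom (f n.unop.dim)
  naturality _ _ φ := ConcreteCategory.hom_ext _ _ fun c => hf φ.unop c

theorem start_face {m n : ℕ} (φ : Box.std m ⟶ Box.std n) (c : X.Cubes n) :
    X.start (X.face φ c) = X.face (Box.vertex (Box.Hom.shift φ)) c := by
  rw [start, ← face_comp, Box.corner_comp]

theorem cornerEdge_face {m n : ℕ} (φ : Box.std m ⟶ Box.std n) (c : X.Cubes n) (i : Fin m) :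
    X.cornerEdge (X.face φ c) i = X.face (Box.edge (Box.Hom.dir φ i) (Box.Hom.shift φ)) c := by
  rw [cornerEdge, ← face_comp, Box.cornerEdge_comp]

theorem start_cornerEdge {n : ℕ} (c : X.Cubes n) (i : Fin n) :
    X.start (X.cornerEdge c i) = X.start c := start_face _ _

theorem start_zero (c : X.Cubes 0) : X.start c = c := by
  rw [start, Box.corner_zero, face_id]

theorem cornerEdge_one (c : X.Cubes 1) (i : Fin 1) : X.cornerEdge c i = c := by
  rw [cornerEdge, Box.cornerEdge_one, face_id]

/-- If edges at a common vertex are determined by their images, then two cubes with a common corner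
and the same image have the same one-skeleton: compare them along paths of edges. -/
theorem face_edge_eq (f : X ⟶ Y)
    (hf : ∀ e₁ e₂ : X.Cubes 1, X.start e₁ = X.start e₂ → onCubes f e₁ = onCubes f e₂ → e₁ = e₂)
    {n : ℕ} {c₁ c₂ : X.Cubes n} (hs : X.start c₁ = X.start c₂)
    (hc : onCubes f c₁ = onCubes f c₂) (φ : Box.std 1 ⟶ Box.std n) :
    X.face φ c₁ = X.face φ c₂ := by
  have edges : ∀ (x : Fin n → ZMod 2) (i : Fin n),
      X.face (Box.vertex x) c₁ = X.face (Box.vertex x) c₂ →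
        X.face (Box.edge i x) c₁ = X.face (Box.edge i x) c₂ := by
    intro x i h
    refine hf _ _ ?_ ?_
    · rw [start_face, start_face]; exact h
    · rw [onCubes_face, onCubes_face, hc]
  have verts : ∀ x, X.face (Box.vertex x) c₁ = X.face (Box.vertex x) c₂ := by
    refine Box.vertex_induction hs fun x i h => ?_
    rw [← Box.vertex_comp_edge, face_comp, face_comp, edges x i h]
  rw [Box.eq_edge φ]
  exact edges _ _ (verts _)

end CubeSet

/-! ### Cubes of the quotient of the Davis complex -/

section Davis

open CubeSet

variable {V : Type} {Γ : SimpleGraph V} {G : Type} [Group G] (cs : CoxeterSystem (racgMatrix Γ) G)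

/-- The abelianization of the right-angled Coxeter group, a vector space over `ZMod 2`. -/
def racgAbelianization : G →* Multiplicative (V → ZMod 2) :=
  letI := Classical.decEq V
  cs.lift ⟨fun s => Multiplicative.ofAdd (Pi.single s 1), by
    have h2 : ∀ y : V → ZMod 2, y + y = 0 := fun y => funext fun v => CharTwo.add_self_eq_zero (y v)
    intro s t
    rw [← ofAdd_add, ← ofAdd_nsmul, ofAdd_eq_one]
    simp only [racgMatrix, Matrix.of_apply]
    split_ifs with h
    · rw [h, h2, smul_zero]
    · rw [two_nsmul, h2]
    · rw [zero_smul]⟩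

theorem racgAbelianization_simple [DecidableEq V] (s : V) :
    racgAbelianization cs (cs.simple s) = Multiplicative.ofAdd (Pi.single s 1) := by
  refine (cs.lift_apply_simple _ s).trans ?_
  congr
  exact Subsingleton.elim _ _

theorem racg_simple_injective : Function.Injective cs.simple := by
  classical
  intro s t h
  have h' := congrArg (racgAbelianization cs) h
  rw [racgAbelianization_simple, racgAbelianization_simple] at h'
  by_contra hst
  have := congrFun (Multiplicative.ofAdd.injective h') s
  simp [hst] at this

theorem racg_simple_commute {s t : V} (h : Γ.Adj s t) : Commute (cs.simple s) (cs.simple t) := by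
  have h2 := cs.simple_mul_simple_pow s t
  have hM : (racgMatrix Γ) s t = 2 := by
    simp [racgMatrix, h.ne, h]
  rw [hM, pow_two] at h2
  have := eq_inv_of_mul_eq_one_left h2
  rw [mul_inv_rev, cs.inv_simple, cs.inv_simple] at this
  exact this

variable {cs}

/-- The vertices of a Davis cube are pairwise distinct. -/
theorem DavisCube.vertex_injective {n : ℕ} (c : DavisCube cs n) : Function.Injective c.vertex := by
  classical
  obtain ⟨t, ht, hc⟩ := c.exists_labels
  have hti : Function.Injective t := fun i j hij => by
    by_contra h
    exact (ht h).ne hij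
  let χ : G → V → ZMod 2 := fun g => Multiplicative.toAdd (racgAbelianization cs g)
  -- In the abelianization, the coordinate `x i` of a vertex is seen in the component at `t i`.
  have hχ : ∀ x i, χ (c.vertex x) (t i) = χ (c.vertex 0) (t i) + x i := by
    intro x i
    revert i
    refine Box.vertex_induction (p := fun x => ∀ i, χ (c.vertex x) (t i) =
      χ (c.vertex 0) (t i) + x i) (by simp) (fun x j hx i => ?_) x
    simp only [χ, hc, map_mul, racgAbelianization_simple, toAdd_mul, toAdd_ofAdd, Pi.add_apply]
    have := hx i
    simp only [χ] at this
    rw [this, add_assoc, Pi.single_apply, Pi.single_apply, hti.eq_iff]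
    split_ifs <;> rfl
  intro x y hxy
  funext i
  have h1 := hχ x i
  rw [hxy, hχ y i] at h1
  exact (add_left_cancel h1).symm

/-- Two Davis cubes with a common corner and the same labels are equal. -/
theorem DavisCube.eq_of_labels {n : ℕ} {c d : DavisCube cs n} {t : Fin n → V}
    (hc : ∀ x i, c.vertex (x + Pi.single i 1) = c.vertex x * cs.simple (t i))
    (hd : ∀ x i, d.vertex (x + Pi.single i 1) = d.vertex x * cs.simple (t i))
    (h0 : c.vertex 0 = d.vertex 0) : c = d :=
  DavisCube.ext (funext (Box.vertex_induction h0 fun x i h => by rw [hc, hd, h]))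

/-- Left translation of a Davis cube. -/
def DavisCube.translate {n : ℕ} (g : G) (c : DavisCube cs n) : DavisCube cs n where
  vertex x := g * c.vertex x
  exists_labels := by
    obtain ⟨t, ht, hc⟩ := c.exists_labels
    exact ⟨t, ht, fun x i => by rw [hc, mul_assoc]⟩

variable (cs)

/-- The homomorphism from the group of order two that sends the generator to `cs.simple s`. -/
def simpleHom (s : V) : Multiplicative (ZMod 2) →* G where
  toFun y := if Multiplicative.toAdd y = 0 then 1 else cs.simple s
  map_one' := by simp
  map_mul' x y := by
    have h : ∀ y : ZMod 2, y = 0 ∨ y = 1 := by decide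
    have h11 : (1 : ZMod 2) + 1 = 0 := by decide
    rcases h x.toAdd with hx | hx <;> rcases h y.toAdd with hy | hy <;> simp [hx, hy, h11]

theorem exists_davisCube {n : ℕ} {t : Fin n → V} (ht : Pairwise fun i j => Γ.Adj (t i) (t j)) :
    ∃ c : DavisCube cs n, ∀ x i, c.vertex (x + Pi.single i 1) = c.vertex x * cs.simple (t i) := by
  have hcomm : Pairwise fun i j => ∀ x y, Commute (simpleHom cs (t i) x) (simpleHom cs (t j) y) := by
    intro i j hij x y
    simp only [simpleHom, MonoidHom.coe_mk, OneHom.coe_mk]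
    split_ifs
    · exact Commute.one_left _
    · exact Commute.one_left _
    · exact Commute.one_right _
    · exact racg_simple_commute cs (ht hij)
  let F := MonoidHom.noncommPiCoprod _ hcomm
  have hF : ∀ (x : Fin n → ZMod 2) i,
      F (fun j => Multiplicative.ofAdd (x j + (Pi.single i 1 : Fin n → ZMod 2) j)) =
      F (fun j => Multiplicative.ofAdd (x j)) * cs.simple (t i) := by
    intro x i
    have h1 : (fun j => Multiplicative.ofAdd (x j + (Pi.single i 1 : Fin n → ZMod 2) j)) =
        (fun j => Multiplicative.ofAdd (x j)) *
          Pi.mulSingle i (Multiplicative.ofAdd (1 : ZMod 2)) := by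
      funext j
      by_cases hij : j = i
      · subst hij; simp
      · simp [hij]
    rw [h1, map_mul, MonoidHom.noncommPiCoprod_mulSingle]
    simp [simpleHom]
  exact ⟨⟨fun x => F fun j => Multiplicative.ofAdd (x j), t, ht, hF⟩, hF⟩

/-- The cube of `Y` represented by a Davis cube. -/
def davisQuotientMk {n : ℕ} (c : DavisCube cs n) : (davisQuotient cs).Cubes n :=
  Quotient.mk (davisSetoid cs n) c

/-- The labels of a cube of `Y`, one for each of its directions.  They do not depend on the
representative chosen here, by `davisLabels_mk`. -/
def davisLabels {n : ℕ} (d : (davisQuotient cs).Cubes n) : Fin n → V :=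
  Classical.choose (Quotient.out d : DavisCube cs n).exists_labels

theorem davisLabels_adj {n : ℕ} (d : (davisQuotient cs).Cubes n) :
    Pairwise fun i j => Γ.Adj (davisLabels cs d i) (davisLabels cs d j) :=
  (Classical.choose_spec (Quotient.out d : DavisCube cs n).exists_labels).1

theorem davisLabels_injective {n : ℕ} (d : (davisQuotient cs).Cubes n) :
    Function.Injective (davisLabels cs d) := fun i j hij => by
  by_contra h
  exact (davisLabels_adj cs d h).ne hij

variable {cs}

theorem exists_davisQuotientMk {n : ℕ} (d : (davisQuotient cs).Cubes n) :
    ∃ c, davisQuotientMk cs c = d := Quotient.exists_rep (s := davisSetoid cs n) d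

theorem davisLabels_mk {n : ℕ} {c : DavisCube cs n} {t : Fin n → V}
    (hc : ∀ x i, c.vertex (x + Pi.single i 1) = c.vertex x * cs.simple (t i)) :
    davisLabels cs (davisQuotientMk cs c) = t := by
  set d : (davisQuotient cs).Cubes n := davisQuotientMk cs c
  obtain ⟨g, hg⟩ : ∃ g : G, ∀ x, (Quotient.out d : DavisCube cs n).vertex x = g * c.vertex x :=
    (davisSetoid cs n).symm (Quotient.mk_out (s := davisSetoid cs n) c)
  have h := (Classical.choose_spec (Quotient.out d : DavisCube cs n).exists_labels).2
  funext i
  refine racg_simple_injective cs ?_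
  have h1 := h 0 i
  rw [hg, hg, hc, ← mul_assoc] at h1
  exact (mul_left_cancel h1).symm

theorem vertex_davisLabels {n : ℕ} (c : DavisCube cs n) (x : Fin n → ZMod 2) (i : Fin n) :
    c.vertex (x + Pi.single i 1) = c.vertex x *
      cs.simple (davisLabels cs (davisQuotientMk cs c) i) := by
  obtain ⟨t, -, hc⟩ := c.exists_labels
  rw [davisLabels_mk hc, hc]

/-- Cubes of `Y` are determined by their labels. -/
theorem davisQuotient_ext {n : ℕ} {d₁ d₂ : (davisQuotient cs).Cubes n}
    (h : davisLabels cs d₁ = davisLabels cs d₂) : d₁ = d₂ := by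
  obtain ⟨c₁, rfl⟩ := exists_davisQuotientMk d₁
  obtain ⟨c₂, rfl⟩ := exists_davisQuotientMk d₂
  refine Quotient.sound ⟨c₂.vertex 0 * (c₁.vertex 0)⁻¹, fun x => ?_⟩
  have h1 := vertex_davisLabels c₁
  have h2 := vertex_davisLabels c₂
  rw [h] at h1
  have := DavisCube.eq_of_labels (c := c₂) (d := c₁.translate (c₂.vertex 0 * (c₁.vertex 0)⁻¹)) h2
    (fun x i => by simp only [DavisCube.translate]; rw [h1]; simp only [mul_assoc])
    (by simp [DavisCube.translate])
  exact congrFun (congrArg DavisCube.vertex this) x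

theorem davisLabels_face {m n : ℕ} (φ : Box.std m ⟶ Box.std n) (d : (davisQuotient cs).Cubes n)
    (a : Fin m) :
    davisLabels cs ((davisQuotient cs).face φ d) a = davisLabels cs d (Box.Hom.dir φ a) := by
  obtain ⟨c, rfl⟩ := exists_davisQuotientMk d
  have h := vertex_davisLabels c
  have := davisLabels_mk (c := DavisCube.face cs φ c)
    (t := fun a => davisLabels cs (davisQuotientMk cs c)
      (Box.Hom.dir φ a))
    (fun x i => by simp only [DavisCube.face]; rw [Box.Hom.vert_add_single, h])
  exact congrFun this a

theorem davisLabels_cornerEdge {n : ℕ} (d : (davisQuotient cs).Cubes n) (i : Fin n) (a : Fin 1) :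
    davisLabels cs ((davisQuotient cs).cornerEdge d i) a = davisLabels cs d i :=
  davisLabels_face _ _ _

theorem davisLabels_edge (s : V) : davisLabels cs (davisQuotientEdge cs s) = fun _ => s := by
  obtain ⟨t, -, hc⟩ := (davisEdge cs s).exists_labels
  refine (davisLabels_mk hc).trans (funext fun i => racg_simple_injective cs ?_)
  have := hc 0 i
  simpa [davisEdge, Subsingleton.elim i 0] using this.symm

theorem davisQuotientEdge_label (e : (davisQuotient cs).Cubes 1) :
    davisQuotientEdge cs (davisLabels cs e 0) = e :=
  davisQuotient_ext ((davisLabels_edge _).trans (funext fun i => by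
    rw [Subsingleton.elim i 0]))

theorem exists_davisLabels_eq {n : ℕ} {t : Fin n → V}
    (ht : Pairwise fun i j => Γ.Adj (t i) (t j)) :
    ∃ d : (davisQuotient cs).Cubes n, davisLabels cs d = t := by
  obtain ⟨c, hc⟩ := exists_davisCube cs ht
  exact ⟨davisQuotientMk cs c, davisLabels_mk hc⟩

theorem davisQuotient_ext_cornerEdge {n : ℕ} {d₁ d₂ : (davisQuotient cs).Cubes n}
    (h : ∀ i, (davisQuotient cs).cornerEdge d₁ i = (davisQuotient cs).cornerEdge d₂ i) :
    d₁ = d₂ :=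
  davisQuotient_ext (funext fun i => by
    rw [← davisLabels_cornerEdge d₁ i 0, h, davisLabels_cornerEdge])

theorem davisQuotient_spans {n : ℕ} {e : Fin n → (davisQuotient cs).Cubes 1}
    (h : Pairwise fun i j => Γ.Adj (davisLabels cs (e i) 0) (davisLabels cs (e j) 0)) :
    (davisQuotient cs).Spans e := by
  obtain ⟨d, hd⟩ := exists_davisLabels_eq (cs := cs) h
  refine ⟨d, fun i => davisQuotient_ext (funext fun a => ?_)⟩
  rw [davisLabels_cornerEdge, hd, Subsingleton.elim a 0]

theorem dim_le_card [Finite V] {n : ℕ} (d : (davisQuotient cs).Cubes n) : n ≤ Nat.card V := by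
  simpa using Nat.card_le_card_of_injective _ (davisLabels_injective cs d)

/-! ### The quotient of the Davis complex by a torsion-free subgroup -/

variable (cs) (H : Subgroup G)

/-- Two cubes of the Davis complex are equivalent if they differ by left multiplication by an
element of the subgroup `H`. -/
def davisCoverSetoid (n : ℕ) : Setoid (DavisCube cs n) where
  r c d := ∃ g ∈ H, ∀ x, d.vertex x = g * c.vertex x
  iseqv :=
    { refl := fun c => ⟨1, H.one_mem, fun x => (one_mul _).symm⟩
      symm := by
        rintro c d ⟨g, hg, h⟩
        exact ⟨g⁻¹, H.inv_mem hg, fun x => by rw [h x, inv_mul_cancel_left]⟩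
      trans := by
        rintro c d e ⟨g, hg, h⟩ ⟨g', hg', h'⟩
        exact ⟨g' * g, H.mul_mem hg' hg, fun x => by rw [h' x, h x, mul_assoc]⟩ }

/-- The quotient of the Davis complex by the subgroup `H`. -/
def davisCover : CubeSet where
  obj n := Quotient (davisCoverSetoid cs H n.unop.dim)
  map φ := TypeCat.ofHom (Quotient.map (DavisCube.face cs φ.unop) fun _ _ ⟨g, hg, h⟩ =>
    ⟨g, hg, fun x => h (Box.Hom.vert φ.unop x)⟩)
  map_id _ := ConcreteCategory.hom_ext _ _ fun c => by
    obtain ⟨c, rfl⟩ := Quotient.exists_rep c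
    exact congrArg (Quotient.mk _) (DavisCube.face_id cs c)
  map_comp φ ψ := ConcreteCategory.hom_ext _ _ fun c => by
    obtain ⟨c, rfl⟩ := Quotient.exists_rep c
    exact congrArg (Quotient.mk _) (DavisCube.face_comp cs ψ.unop φ.unop c)

/-- The cube of `H \ Ỹ` represented by a Davis cube. -/
def davisCoverMk {n : ℕ} (c : DavisCube cs n) : (davisCover cs H).Cubes n :=
  Quotient.mk (davisCoverSetoid cs H n) c

/-- The covering map `H \ Ỹ → Y`. -/
def davisCoverMap : davisCover cs H ⟶ davisQuotient cs :=
  homMk (fun n => Quotient.lift (davisQuotientMk cs)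
      fun _ _ ⟨g, _, h⟩ => Quotient.sound ⟨g, h⟩)
    (fun {m n} φ c => by
      obtain ⟨c, rfl⟩ := Quotient.exists_rep (s := davisCoverSetoid cs H n) c
      rfl)

/-- `H \ Ỹ` as a complex over `Y`. -/
def davisCoverOver : Over (davisQuotient cs) := Over.mk (davisCoverMap cs H)

variable {cs H}

theorem exists_davisCoverMk {n : ℕ} (c : (davisCover cs H).Cubes n) :
    ∃ c', davisCoverMk cs H c' = c := Quotient.exists_rep (s := davisCoverSetoid cs H n) c

theorem davisCoverMk_eq {n : ℕ} {c d : DavisCube cs n} :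
    davisCoverMk cs H c = davisCoverMk cs H d ↔ ∃ g ∈ H, ∀ x, d.vertex x = g * c.vertex x :=
  Quotient.eq (r := davisCoverSetoid cs H n)

theorem davisQuotientMk_eq {n : ℕ} {c d : DavisCube cs n} :
    davisQuotientMk cs c = davisQuotientMk cs d ↔ ∃ g, ∀ x, d.vertex x = g * c.vertex x :=
  Quotient.eq (r := davisSetoid cs n)

theorem DavisCube.face_corner_vertex {n : ℕ} (c : DavisCube cs n) (x : Fin 0 → ZMod 2) :
    (DavisCube.face cs (Box.corner n) c).vertex x = c.vertex 0 := by
  rw [Subsingleton.elim x 0]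
  exact congrArg c.vertex (Box.vert_zero _)

/-- The action of `G` on the vertices of the Davis complex is free, so `H \ Ỹ → Y` is a
covering. -/
theorem davisCoverMap_isLocalIsometry : IsLocalIsometry (davisCoverMap cs H) := by
  constructor
  · intro n c₁ c₂ hs hc
    obtain ⟨c₁, rfl⟩ := exists_davisCoverMk c₁
    obtain ⟨c₂, rfl⟩ := exists_davisCoverMk c₂
    obtain ⟨h, hH, hh⟩ := davisCoverMk_eq.1 hs
    obtain ⟨g, hg⟩ := davisQuotientMk_eq.1 hc
    refine davisCoverMk_eq.2 ⟨h, hH, fun x => ?_⟩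
    have h0 : c₂.vertex 0 = h * c₁.vertex 0 := by
      rw [← c₂.face_corner_vertex 0, ← c₁.face_corner_vertex 0]
      exact hh 0
    rw [hg 0] at h0
    rw [← mul_right_cancel h0, hg x]
  · intro n v d _ _
    obtain ⟨v, rfl⟩ := exists_davisCoverMk v
    obtain ⟨d, rfl⟩ := exists_davisQuotientMk d
    refine ⟨davisCoverMk cs H (d.translate (v.vertex 0 * (d.vertex 0)⁻¹)),
      davisCoverMk_eq.2 ⟨1, H.one_mem, fun x => ?_⟩, davisQuotientMk_eq.2
        ⟨(v.vertex 0 * (d.vertex 0)⁻¹)⁻¹, fun x => by simp [DavisCube.translate, mul_assoc]⟩⟩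
    refine Eq.trans ?_ (congrArg (1 * ·) (DavisCube.face_corner_vertex _ x).symm)
    rw [Subsingleton.elim (α := Fin 0 → ZMod 2) x 0]
    simp [DavisCube.translate]

/-- An isometry of a cube of `Ỹ` induced by `H` preserves labels, hence is a translation of the
cube; its square is trivial, so it is trivial when `H` is torsion-free. -/
theorem davisCover_isCubeComplex (hH : ∀ h ∈ H, IsOfFinOrder h → h = 1) :
    (davisCover cs H).IsCubeComplex := by
  intro n c σ hσ
  obtain ⟨c, rfl⟩ := exists_davisCoverMk c
  obtain ⟨g, hg, h⟩ := davisCoverMk_eq.1 hσ.symm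
  replace h : ∀ x, c.vertex (Box.Hom.vert σ x) = g * c.vertex x := h
  obtain ⟨t, ht, hc⟩ := c.exists_labels
  -- Both `g` and `σ` move edges to edges, and `g` preserves their labels, which are distinct.
  have hdir : ∀ i, Box.Hom.dir σ i = i := by
    intro i
    have h1 := h (0 + Pi.single i 1)
    rw [Box.Hom.vert_add_single, hc, hc, h 0, ← mul_assoc] at h1
    by_contra hne
    exact (ht hne).ne (racg_simple_injective cs (mul_left_cancel h1))
  have hvert : ∀ x, Box.Hom.vert σ x = Box.Hom.shift σ + x := by
    intro x
    funext i
    have := Box.Hom.vert_dir σ x i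
    rwa [hdir] at this
  have h1 : c.vertex (Box.Hom.shift σ) = g * c.vertex 0 := by
    rw [← h, hvert, add_zero]
  have hss : Box.Hom.shift σ + Box.Hom.shift σ = 0 :=
    funext fun i => CharTwo.add_self_eq_zero (Box.Hom.shift σ i)
  have h2 : c.vertex 0 = g * (g * c.vertex 0) := by
    rw [← h1, ← h, hvert, hss]
  have hg2 : g ^ 2 = 1 := by
    rw [← mul_assoc, right_eq_mul] at h2
    rw [pow_two, h2]
  have hg1 := hH g hg (isOfFinOrder_iff_pow_eq_one.2 ⟨2, two_pos, hg2⟩)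
  rw [hg1, one_mul] at h1
  exact Box.hom_ext hdir (c.vertex_injective h1)

/-! ### The map from the bouquet to the cover -/

/-- The vertex of the Davis complex given by a group element. -/
def davisPoint (cs : CoxeterSystem (racgMatrix Γ) G) (g : G) : DavisCube cs 0 where
  vertex _ := g
  exists_labels := ⟨Fin.elim0, fun i => i.elim0, fun _ i => i.elim0⟩

/-- The element of `G` spelled by the letters of `w i` before the position `l`. -/
def bouquetPrefix (cs : CoxeterSystem (racgMatrix Γ) G) {k : ℕ} (w : Fin k → List V)
    (i : Fin k) (l : ℕ) : G := cs.wordProd ((w i).take l)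

/-- The edge of the Davis complex read by the edge `a` of the bouquet, in its orientation `ε`. -/
def bouquetDavisEdge (cs : CoxeterSystem (racgMatrix Γ) G) {k : ℕ} (w : Fin k → List V)
    (a : BouquetEdge w) (ε : ZMod 2) : DavisCube cs 1 :=
  DavisCube.face cs (Box.edge 0 fun _ => ε)
    ((davisEdge cs (bouquetLetter w a)).translate (bouquetPrefix cs w a.1 a.2))

/-- The lift to `H \ Ỹ` of the map from the bouquet to `Y`. -/
def bouquetCoverCube (cs : CoxeterSystem (racgMatrix Γ) G) (H : Subgroup G) {k : ℕ}
    (w : Fin k → List V) :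
    ∀ {n : ℕ}, GraphCube (BouquetVertex w) (BouquetEdge w) n → (davisCover cs H).Cubes n
  | _, .vertex none => davisCoverMk cs H (davisPoint cs 1)
  | _, .vertex (some a) => davisCoverMk cs H (davisPoint cs (bouquetPrefix cs w a.1.1 a.1.2))
  | _, .edge a ε => davisCoverMk cs H (bouquetDavisEdge cs w a ε)

/-- The formula for the lift also holds at the end point of each circle, since the word that labels
the circle represents an element of `H`. -/
theorem bouquetCoverCube_point (H : Subgroup G) {k : ℕ} (w : Fin k → List V)
    (hw : ∀ i, cs.wordProd (w i) ∈ H) (i : Fin k) {l : ℕ} (hl : l ≤ (w i).length) :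
    bouquetCoverCube cs H w (.vertex (bouquetPoint w i l)) =
      davisCoverMk cs H (davisPoint cs (bouquetPrefix cs w i l)) := by
  unfold bouquetPoint
  split_ifs with h
  · rfl
  · refine davisCoverMk_eq.2 ⟨bouquetPrefix cs w i l, ?_, fun _ => (mul_one _).symm⟩
    rcases Nat.eq_zero_or_pos l with rfl | h0
    · simp [bouquetPrefix, H.one_mem]
    · obtain rfl : l = (w i).length := le_antisymm hl (not_lt.1 fun h' => h ⟨h0.ne', h'⟩)
      simpa [bouquetPrefix] using hw i

theorem bouquetPrefix_succ {k : ℕ} (w : Fin k → List V) (a : BouquetEdge w) :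
    bouquetPrefix cs w a.1 (a.2 + 1) =
      bouquetPrefix cs w a.1 a.2 * cs.simple (bouquetLetter w a) := by
  rw [bouquetPrefix, ← List.take_concat_get' _ _ a.2.isLt, cs.wordProd_append,
    cs.wordProd_singleton]
  rfl

theorem bouquetCoverCube_face (H : Subgroup G) {k : ℕ} (w : Fin k → List V)
    (hw : ∀ i, cs.wordProd (w i) ∈ H) :
    ∀ {m n : ℕ} (φ : Box.std m ⟶ Box.std n) (c : GraphCube (BouquetVertex w) (BouquetEdge w) n),
      bouquetCoverCube cs H w (GraphCube.face (bouquetBoundary w) φ c) =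
        (davisCover cs H).face φ (bouquetCoverCube cs H w c)
  | 0, _, _, .vertex none => davisCoverMk_eq.2 ⟨1, H.one_mem, fun _ => (one_mul _).symm⟩
  | 0, _, _, .vertex (some _) => davisCoverMk_eq.2 ⟨1, H.one_mem, fun _ => (one_mul _).symm⟩
  | 0, _, φ, .edge a ε => by
      have hv : (DavisCube.face cs φ (bouquetDavisEdge cs w a ε)).vertex 0 =
          bouquetPrefix cs w a.1 a.2 * if ε + Box.Hom.shift φ (0 : Fin 1) = 0 then 1
            else cs.simple (bouquetLetter w a) := by
        have h := Box.Hom.vert_dir (Box.edge (0 : Fin 1) fun _ => ε) (Box.Hom.shift φ) (0 : Fin 1)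
        simp only [bouquetDavisEdge, DavisCube.face, DavisCube.translate, davisEdge, Box.vert_zero]
        exact congrArg (fun z : ZMod 2 => bouquetPrefix cs w a.1 a.2 *
          if z = 0 then 1 else cs.simple (bouquetLetter w a)) h
      refine (bouquetCoverCube_point H w hw a.1 ?_).trans
        (davisCoverMk_eq.2 ⟨1, H.one_mem, fun x => ?_⟩)
      · split_ifs <;> omega
      · rw [one_mul, Subsingleton.elim (α := Fin 0 → ZMod 2) x 0]
        refine hv.trans ?_
        change _ = bouquetPrefix cs w a.1 (if ε + Box.Hom.shift φ (0 : Fin 1) = 0 then _ else _)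
        split_ifs
        · rw [mul_one]
        · rw [bouquetPrefix_succ]
  | 1, _, φ, .edge a ε => by
      refine congrArg (davisCoverMk cs H) ?_
      have h : Box.edge (0 : Fin 1) (fun _ => ε + Box.Hom.shift φ (0 : Fin 1)) =
          φ ≫ Box.edge (0 : Fin 1) fun _ => ε := by
        refine Box.hom_ext (fun _ => Subsingleton.elim (α := Fin 1) _ _) (funext fun i => ?_)
        rw [Subsingleton.elim (α := Fin 1) i 0]
        exact (Box.Hom.vert_dir (Box.edge (0 : Fin 1) fun _ => ε) (Box.Hom.shift φ)
          (0 : Fin 1)).symm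
      refine Eq.trans ?_ (DavisCube.face_comp cs φ (Box.edge (0 : Fin 1) fun _ => ε) _)
      rw [← h]
      rfl
  | l + 1, _, φ, .vertex _ => (Box.Hom.dir φ (0 : Fin (l + 1))).elim0
  | l + 2, _, φ, .edge _ _ =>
      absurd ((Box.Hom.dir φ).injective (Subsingleton.elim (α := Fin 1)
        (Box.Hom.dir φ (0 : Fin (l + 2))) (Box.Hom.dir φ (1 : Fin (l + 2))))) (by simp)

theorem davisQuotient_ext_zero (d₁ d₂ : (davisQuotient cs).Cubes 0) : d₁ = d₂ :=
  davisQuotient_ext (funext fun i => i.elim0)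

/-- The words `w i` represent elements of `H`, so the map from the bouquet to `Y` lifts to
`H \ Ỹ`. -/
theorem nonempty_bouquetOver_hom (H : Subgroup G) {k : ℕ} (w : Fin k → List V)
    (hw : ∀ i, cs.wordProd (w i) ∈ H) : Nonempty (bouquetOver cs w ⟶ davisCoverOver cs H) := by
  let f : bouquet w ⟶ davisCover cs H :=
    homMk (X := bouquet w) (fun _ => bouquetCoverCube cs H w) (bouquetCoverCube_face H w hw)
  refine ⟨Over.homMk f (hom_ext fun n c => ?_)⟩
  match n, c with
  | _, .vertex _ => exact davisQuotient_ext_zero _ _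
  | _, .edge a ε =>
    refine davisQuotient_ext ?_
    change davisLabels cs ((davisQuotient cs).face (Box.edge 0 fun _ => ε) (davisQuotientMk cs
      ((davisEdge cs (bouquetLetter w a)).translate (bouquetPrefix cs w a.1 a.2)))) =
        davisLabels cs (davisQuotientEdge cs (bouquetLetter w a))
    have h : davisQuotientMk cs
        ((davisEdge cs (bouquetLetter w a)).translate (bouquetPrefix cs w a.1 a.2)) =
          davisQuotientEdge cs (bouquetLetter w a) :=
      (davisQuotientMk_eq.2 ⟨_, fun _ => rfl⟩).symm
    rw [h]
    funext i
    rw [davisLabels_face, davisLabels_edge]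

end Davis

/-! ### Labeled complexes as complexes over `Y` -/

namespace LabeledComplex

open CubeSet

section

variable {V : Type} {Γ : SimpleGraph V} (A : LabeledComplex Γ)

/-- The label of an edge of a cube depends only on the direction of the edge. -/
theorem label_face_edge {n : ℕ} (c : A.complex.Cubes n) (φ : Box.std 1 ⟶ Box.std n) :
    A.label (A.complex.face φ c) = A.label (A.complex.cornerEdge c (Box.Hom.dir φ 0)) := by
  have key : ∀ (i : Fin n) (x : Fin n → ZMod 2),
      A.label (A.complex.face (Box.edge i x) c) = A.label (A.complex.face (Box.edge i 0) c) := by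
    intro i
    refine Box.eq_of_edge_invariant fun x j => ?_
    by_cases hij : i = j
    · subst hij
      have h : Box.edge i (x + Pi.single i 1) =
          (Box.edge (0 : Fin 1) (Pi.single 0 1)) ≫ Box.edge i x := by
        rw [Box.edge_comp]
        have := Box.Hom.vert_add_single (Box.edge i x) 0 (0 : Fin 1)
        rw [zero_add, Box.vert_zero] at this
        rw [this]
        rfl
      rw [h, face_comp, A.label_reparam]
    · have h₁ : Box.edge i x = Box.edge (0 : Fin 2) 0 ≫ Box.square hij x := by
        rw [Box.edge_comp, Box.vert_zero]; rfl
      have h₂ : Box.edge i (x + Pi.single j 1) =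
          Box.edge (0 : Fin 2) (Pi.single 1 1) ≫ Box.square hij x := by
        rw [Box.edge_comp]
        have := Box.Hom.vert_add_single (Box.square hij x) 0 (1 : Fin 2)
        rw [zero_add, Box.vert_zero] at this
        rw [this]
        rfl
      rw [h₁, h₂, face_comp, face_comp]
      exact A.label_parallel _ _ _ rfl
  rw [Box.eq_edge φ, key]
  rfl

theorem label_cornerEdge_adj {n : ℕ} (c : A.complex.Cubes n) :
    Pairwise fun i j => Γ.Adj (A.label (A.complex.cornerEdge c i))
      (A.label (A.complex.cornerEdge c j)) := by
  intro i j hij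
  have h := A.label_adj (A.complex.face (Box.square hij 0) c) (Box.edge 0 0) (Box.edge 1 0)
    (by change (0 : Fin 2) ≠ 1; decide)
  rw [← face_comp, ← face_comp, label_face_edge, label_face_edge] at h
  exact h

end

variable {V : Type} {Γ : SimpleGraph V} {G : Type} [Group G] (cs : CoxeterSystem (racgMatrix Γ) G)

/-- The cube of `Y` with the same labels as the cube `c` of a labeled complex. -/
def davisImage (A : LabeledComplex Γ) {n : ℕ} (c : A.complex.Cubes n) :
    (davisQuotient cs).Cubes n :=
  Classical.choose (exists_davisLabels_eq (cs := cs) (A.label_cornerEdge_adj c))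

theorem davisLabels_davisImage (A : LabeledComplex Γ) {n : ℕ} (c : A.complex.Cubes n) (i : Fin n) :
    davisLabels cs (A.davisImage cs c) i = A.label (A.complex.cornerEdge c i) :=
  congrFun (Classical.choose_spec (exists_davisLabels_eq (cs := cs) (A.label_cornerEdge_adj c))) i

/-- The cubical map to `Y` given by the labels. -/
def davisMap (A : LabeledComplex Γ) : A.complex ⟶ davisQuotient cs :=
  homMk (fun _ => A.davisImage cs) fun φ c => davisQuotient_ext (funext fun i => by
    rw [davisLabels_davisImage, davisLabels_face, davisLabels_davisImage, cornerEdge_face,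
      label_face_edge]
    rfl)

theorem davisLabels_davisMap (A : LabeledComplex Γ) {n : ℕ} (c : A.complex.Cubes n) (i : Fin n) :
    davisLabels cs (onCubes (A.davisMap cs) c) i = A.label (A.complex.cornerEdge c i) :=
  A.davisLabels_davisImage cs c i

theorem davisLabels_davisMap_edge (A : LabeledComplex Γ) (e : A.complex.Cubes 1) :
    davisLabels cs (onCubes (A.davisMap cs) e) 0 = A.label e := by
  rw [davisLabels_davisMap, cornerEdge_one]

theorem onCubes_davisMap (A : LabeledComplex Γ) (e : A.complex.Cubes 1) :
    onCubes (A.davisMap cs) e = davisQuotientEdge cs (A.label e) :=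
  davisQuotient_ext (funext fun i => by
    rw [davisLabels_davisMap, davisLabels_edge, cornerEdge_one])

theorem davisMap_eq_iff (A : LabeledComplex Γ) (e₁ e₂ : A.complex.Cubes 1) :
    onCubes (A.davisMap cs) e₁ = onCubes (A.davisMap cs) e₂ ↔ A.label e₁ = A.label e₂ := by
  refine ⟨fun h => ?_, fun h => by rw [onCubes_davisMap, onCubes_davisMap, h]⟩
  have := congrArg (fun d => davisLabels cs d 0) h
  simpa only [davisLabels_davisMap_edge] using this

/-- A cubical map to `Y` over a labeled complex is determined by its effect on edges. -/
theorem eq_davisMap (A : LabeledComplex Γ) {f : A.complex ⟶ davisQuotient cs}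
    (h : ∀ e : A.complex.Cubes 1, onCubes f e = davisQuotientEdge cs (A.label e)) :
    f = A.davisMap cs :=
  hom_ext fun _ c => davisQuotient_ext_cornerEdge fun i => by
    rw [← onCubes_cornerEdge, ← onCubes_cornerEdge, h, onCubes_davisMap]

theorem map_comp_davisMap {A B : LabeledComplex Γ} (g : A ⟶ B) :
    map g ≫ B.davisMap cs = A.davisMap cs :=
  A.eq_davisMap cs fun e => by
    rw [onCubes_comp, onCubes_davisMap]
    exact congrArg _ (Hom.label_eq g e)

/-- Labeled complexes as complexes over `Y`. -/
def toOver : LabeledComplex Γ ⥤ Over (davisQuotient cs) where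
  obj A := Over.mk (A.davisMap cs)
  map g := Over.homMk (map g) (map_comp_davisMap cs g)
  map_id _ := rfl
  map_comp _ _ := rfl

/-- The labeled complex given by a complex over `Y`. -/
def ofOver (Z : Over (davisQuotient cs)) : LabeledComplex Γ where
  complex := Z.left
  label e := davisLabels cs (onCubes Z.hom e) 0
  label_reparam e σ := by
    rw [onCubes_face]
    exact (davisLabels_face _ _ _).trans (congrArg _ (Subsingleton.elim (α := Fin 1) _ _))
  label_parallel c φ ψ h := by
    rw [onCubes_face, onCubes_face]
    exact (davisLabels_face _ _ _).trans ((congrArg _ h).trans (davisLabels_face _ _ _).symm)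
  label_adj c φ ψ h := by
    rw [onCubes_face, onCubes_face, davisLabels_face, davisLabels_face]
    exact davisLabels_adj cs _ h

theorem davisMap_ofOver (Z : Over (davisQuotient cs)) : (ofOver cs Z).davisMap cs = Z.hom :=
  ((ofOver cs Z).eq_davisMap cs fun _ => (davisQuotientEdge_label _).symm).symm

/-- A map of complexes over `Y`, as a label-preserving map. -/
def homOfOver {A B : LabeledComplex Γ} (g : A.complex ⟶ B.complex)
    (hg : g ≫ B.davisMap cs = A.davisMap cs) : A ⟶ B :=
  Hom.mk g fun e => by
    have h : onCubes (B.davisMap cs) (onCubes g e) = onCubes (A.davisMap cs) e := by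
      rw [← hg, onCubes_comp]
    have := congrArg (fun d => davisLabels cs d 0) h
    simpa only [davisLabels_davisMap_edge] using this

instance : (toOver cs).Faithful where
  map_injective {_ _ _ _} h := Hom.ext (congrArg CommaMorphism.left h)

instance : (toOver (Γ := Γ) cs).Full where
  map_surjective g := ⟨homOfOver cs g.left (Over.w g), rfl⟩

instance : (toOver (Γ := Γ) cs).EssSurj where
  mem_essImage Z := ⟨ofOver cs Z, ⟨Over.isoMk (Iso.refl Z.left)
    ((Category.id_comp _).trans (davisMap_ofOver cs Z).symm)⟩⟩

/-- A labeling by `Γ` is the same thing as a cubical map to `Y`. -/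
instance : (toOver (Γ := Γ) cs).IsEquivalence where

end LabeledComplex

/-! ### The moves are orthogonal to local isometries -/

open CubeSet

namespace CubeSet

theorem start_eq_of_cornerEdge_eq {X : CubeSet} {n : ℕ} (hn : 0 < n) {c₁ c₂ : X.Cubes n}
    (h : ∀ i, X.cornerEdge c₁ i = X.cornerEdge c₂ i) : X.start c₁ = X.start c₂ := by
  rw [← start_cornerEdge c₁ ⟨0, hn⟩, h, start_cornerEdge]

/-- Whether edges span a cube does not depend on their order. -/
theorem Spans.of_range_eq {X : CubeSet} {m n : ℕ} {e : Fin m → X.Cubes 1} {e' : Fin n → X.Cubes 1}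
    (he : Function.Injective e) (he' : Function.Injective e') (h : Set.range e = Set.range e')
    {Z : CubeSet} (g : X ⟶ Z) (hz : Z.Spans fun i => onCubes g (e i)) :
    Z.Spans fun i => onCubes g (e' i) := by
  let σ : Fin n ≃ Fin m := (Equiv.ofInjective e' he').trans
    ((Equiv.setCongr h.symm).trans (Equiv.ofInjective e he).symm)
  have hσ : ∀ i, e (σ i) = e' i := fun i => Equiv.apply_ofInjective_symm he _
  obtain rfl : n = m := Fin.equiv_iff_eq.1 ⟨σ⟩
  obtain ⟨c, hc⟩ := hz
  refine ⟨Z.face (Box.permute σ) c, fun i => ?_⟩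
  rw [cornerEdge, ← face_comp, Box.cornerEdge_comp_permute]
  exact (hc (σ i)).trans (congrArg _ (hσ i))

end CubeSet

/-- The local isometries to `Y`, as a class of complexes over `Y`. -/
def localIsometries (Y : CubeSet) : ObjectProperty (Over Y) := fun Z => IsLocalIsometry Z.hom

section

variable {Y : CubeSet}

theorem onCubes_hom_left {A B : Over Y} (g : A ⟶ B) {n : ℕ} (c : A.left.Cubes n) :
    onCubes B.hom (onCubes g.left c) = onCubes A.hom c := by
  rw [← onCubes_comp, Over.w]

/-- A map between complexes over `Y` takes cubes with a common corner and equal images in `Y` to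
equal cubes, if its target is immersed in `Y`. -/
theorem onCubes_left_eq {A W : Over Y} (hW : IsImmersion W.hom) (h : A ⟶ W) {n : ℕ}
    {c₁ c₂ : A.left.Cubes n} (hs : A.left.start c₁ = A.left.start c₂)
    (hc : onCubes A.hom c₁ = onCubes A.hom c₂) : onCubes h.left c₁ = onCubes h.left c₂ := by
  refine hW n _ _ ?_ ?_
  · exact start_onCubes_eq _ hs
  · rw [onCubes_hom_left, onCubes_hom_left, hc]

/-- Identifying two cubes with a common corner and the same image in `Y` is orthogonal to local
isometries, since every map to a complex immersed in `Y` takes them to the same cube. -/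
theorem isLocal_of_isIdentification {A B : Over Y} (g : A ⟶ B) {n : ℕ} {c₁ c₂ : A.left.Cubes n}
    (hg : IsIdentification g.left c₁ c₂) (hs : A.left.start c₁ = A.left.start c₂)
    (hc : onCubes A.hom c₁ = onCubes A.hom c₂) : (localIsometries Y).isLocal g := by
  intro W hW
  refine ⟨fun k₁ k₂ h => ?_, fun h => ?_⟩
  · have h' : g.left ≫ k₁.left = g.left ≫ k₂.left := congrArg CommaMorphism.left h
    refine Over.OverMorphism.ext ((hg.2 W.left (g.left ≫ k₁.left) ?_).unique rfl h'.symm)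
    rw [onCubes_comp, onCubes_comp, hg.1]
  · obtain ⟨k, hk, -⟩ := hg.2 W.left h.left (onCubes_left_eq hW.1 h hs hc)
    refine ⟨Over.homMk k ((hg.2 Y A.hom hc).unique ?_ (Over.w g)), Over.OverMorphism.ext hk⟩
    rw [← Category.assoc, hk, Over.w]

/-- In a local isometry, edges at a common vertex span a cube as soon as their images do. -/
theorem spans_of_isLocalIsometry {X : CubeSet} {f : X ⟶ Y} (hf : IsLocalIsometry f) {n : ℕ}
    (hn : 0 < n) {e : Fin n → X.Cubes 1} (hs : ∀ i j, X.start (e i) = X.start (e j))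
    (he : Y.Spans fun i => onCubes f (e i)) : X.Spans e := by
  obtain ⟨d, hd⟩ := he
  obtain ⟨c, hcs, hcd⟩ := hf.2 n (X.start (e ⟨0, hn⟩)) d
    ((start_cornerEdge d ⟨0, hn⟩).symm.trans
      ((congrArg Y.start (hd _)).trans (onCubes_start f _).symm)) fun i => ⟨e i, hs _ _, (hd i).symm⟩
  refine ⟨c, fun i => hf.1 1 _ _ ?_ ?_⟩
  · rw [start_cornerEdge, hcs]
    exact hs _ _
  · rw [onCubes_cornerEdge, hcd, hd]

end

section

variable {V : Type} {Γ : SimpleGraph V} {G : Type} [Group G] {cs : CoxeterSystem (racgMatrix Γ) G}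

theorem davisQuotient_spans_iff {n : ℕ} {e : Fin n → (davisQuotient cs).Cubes 1} :
    (davisQuotient cs).Spans e ↔
      Pairwise fun i j => Γ.Adj (davisLabels cs (e i) 0) (davisLabels cs (e j) 0) := by
  refine ⟨fun ⟨d, hd⟩ i j hij => ?_, davisQuotient_spans⟩
  have : Γ.Adj (davisLabels cs d i) (davisLabels cs d j) := davisLabels_adj cs d hij
  rwa [← davisLabels_cornerEdge d i 0, ← davisLabels_cornerEdge d j 0, hd, hd] at this

/-- Edges whose images in `Y` span a cube are distinct. -/
theorem injective_of_spans {X : CubeSet} {f : X ⟶ davisQuotient cs} {n : ℕ} {e : Fin n → X.Cubes 1}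
    (he : (davisQuotient cs).Spans fun i => onCubes f (e i)) : Function.Injective e := by
  intro i j hij
  by_contra h
  have := davisQuotient_spans_iff.1 he h
  exact this.ne (congrArg (fun e => davisLabels cs (onCubes f e) 0) hij)

/-- Attaching cubes along edges whose images in `Y` span cubes is orthogonal to local isometries. -/
theorem isLocal_of_isAttachment {A B : Over (davisQuotient cs)} (g : A ⟶ B)
    {P : ∀ n : ℕ, (Fin n → A.left.Cubes 1) → Prop} (hg : IsAttachment g.left P)
    (hP : ∀ n e, P n e → 0 < n ∧ (∀ i j, A.left.start (e i) = A.left.start (e j)) ∧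
      (davisQuotient cs).Spans fun i => onCubes A.hom (e i)) :
    (localIsometries (davisQuotient cs)).isLocal g := by
  obtain ⟨I, dim, e, b, hPe, -, hb, hu⟩ := hg
  intro W hW
  refine ⟨fun k₁ k₂ h => ?_, fun h => ?_⟩
  · have h' : g.left ≫ k₁.left = g.left ≫ k₂.left := congrArg CommaMorphism.left h
    have hk : ∀ (k : B ⟶ W) i j, W.left.cornerEdge (onCubes k.left (b i)) j =
        onCubes (g.left ≫ k.left) (e i j) := fun k i j => by
      rw [← onCubes_cornerEdge, hb, onCubes_comp]
    refine Over.OverMorphism.ext ((hu W.left (g.left ≫ k₁.left) (fun i => onCubes k₁.left (b i))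
      (hk k₁)).unique ⟨rfl, fun _ => rfl⟩ ⟨h'.symm, fun i => hW.1 _ _ _ ?_ ?_⟩)
    · exact start_eq_of_cornerEdge_eq (hP _ _ (hPe i)).1 fun j => by rw [hk, hk, h']
    · rw [← onCubes_comp, ← onCubes_comp, Over.w, Over.w]
  · -- The corners to be filled are already filled in the local isometry `W`.
    have hz : ∀ i, ∃ z : W.left.Cubes (dim i), ∀ j, W.left.cornerEdge z j =
        onCubes h.left (e i j) := fun i => by
      obtain ⟨hn, hs, he⟩ := hP _ _ (hPe i)
      refine spans_of_isLocalIsometry hW hn (fun j j' => ?_) ?_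
      · exact start_onCubes_eq _ (hs _ _)
      · simpa only [← onCubes_comp, Over.w] using he
    choose z hz using hz
    obtain ⟨k, ⟨hk, hkb⟩, -⟩ := hu W.left h.left z hz
    have hzY : ∀ i j, (davisQuotient cs).cornerEdge (onCubes W.hom (z i)) j =
        onCubes A.hom (e i j) := fun i j => by
      rw [← onCubes_cornerEdge, hz, ← onCubes_comp, Over.w]
    refine ⟨Over.homMk k ((hu _ A.hom _ hzY).unique ⟨?_, fun i => ?_⟩
      ⟨Over.w g, fun i => davisQuotient_ext_cornerEdge fun j => ?_⟩), Over.OverMorphism.ext hk⟩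
    · rw [← Category.assoc, hk, Over.w]
    · rw [onCubes_comp, hkb]
    · rw [hzY, ← onCubes_cornerEdge, hb, ← onCubes_comp, Over.w]

/-- After an attachment, the edges at which a cube was attached span a cube. -/
theorem CubeSet.IsAttachment.spans {A B : CubeSet} {g : A ⟶ B}
    {P : ∀ n : ℕ, (Fin n → A.Cubes 1) → Prop} (hg : IsAttachment g P)
    (hP : ∀ n e, P n e → Function.Injective e) {n : ℕ} {e' : Fin n → A.Cubes 1} (he' : P n e') :
    B.Spans fun i => onCubes g (e' i) := by
  obtain ⟨I, dim, e, b, hPe, hex, hb, -⟩ := hg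
  obtain ⟨i, hi, -⟩ := hex n e' he'
  exact Spans.of_range_eq (hP _ _ (hPe i)) (hP _ _ he') hi g ⟨b i, hb i⟩

/-! ### One round of either procedure -/

/-- The properties of one round of the completion procedures on which the comparison rests.  The
round is orthogonal to local isometries; and if its source maps to `D`, then it identifies cubes
with a common corner and equal images in `Y`, and fills all corners whose image spans a cube. -/
def completionStep (D : Over (davisQuotient cs)) : MorphismProperty (Over (davisQuotient cs)) :=
  fun A B g => (localIsometries (davisQuotient cs)).isLocal g ∧ (Nonempty (A ⟶ D) →
    (∀ (n : ℕ) (c₁ c₂ : A.left.Cubes n), A.left.start c₁ = A.left.start c₂ →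
      onCubes A.hom c₁ = onCubes A.hom c₂ → onCubes g.left c₁ = onCubes g.left c₂) ∧
    ∀ (n : ℕ) (e : Fin n → A.left.Cubes 1), 2 ≤ n →
      (∀ i j, A.left.start (e i) = A.left.start (e j)) →
      (davisQuotient cs).Spans (fun i => onCubes A.hom (e i)) →
        B.left.Spans fun i => onCubes g.left (e i))

theorem CubeSet.Spans.onCubes {A B : CubeSet} {n : ℕ} {e : Fin n → A.Cubes 1} (h : A.Spans e)
    (g : A ⟶ B) : B.Spans fun i => CubeSet.onCubes g (e i) := by
  obtain ⟨c, hc⟩ := h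
  exact ⟨CubeSet.onCubes g c, fun i => by rw [← onCubes_cornerEdge, hc]⟩

namespace Cubical

theorem isLocal_of_fold {A B : Over (davisQuotient cs)} {g : A ⟶ B} (hg : fold _ g) :
    (localIsometries (davisQuotient cs)).isLocal g := by
  obtain ⟨e₁, e₂, h, hg⟩ := hg
  exact isLocal_of_isIdentification g hg h.2.1 h.2.2

theorem isLocal_of_cubeIdentification {A B : Over (davisQuotient cs)} {g : A ⟶ B}
    (hg : cubeIdentification _ g) : (localIsometries (davisQuotient cs)).isLocal g := by
  obtain ⟨n, c₁, c₂, ⟨hn, -, h⟩, hg⟩ := hg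
  refine isLocal_of_isIdentification g hg
    (start_eq_of_cornerEdge_eq (by omega) fun i => h (Box.cornerEdge n i))
    (davisQuotient_ext_cornerEdge fun i => ?_)
  rw [← onCubes_cornerEdge, ← onCubes_cornerEdge]
  exact congrArg _ (h (Box.cornerEdge n i))

theorem completionRound_le (D : Over (davisQuotient cs)) :
    completionRound (davisQuotient cs) ≤ completionStep D := by
  rintro A E g ⟨B, C, p, q, r, rfl, hp, hB, hq, hC, hr⟩
  have hp' := (MorphismProperty.multiplicativeClosure_le_iff _ _).2
    (fun _ _ _ h => isLocal_of_fold h) _ hp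
  have hq' := (MorphismProperty.multiplicativeClosure_le_iff _ _).2
    (fun _ _ _ h => isLocal_of_cubeIdentification h) _ hq
  have hr' : (localIsometries (davisQuotient cs)).isLocal r :=
    isLocal_of_isAttachment r hr fun n e he => ⟨by have := he.1; omega, he.2.2.1, he.2.2.2.1⟩
  refine ⟨MorphismProperty.comp_mem _ _ _ hp' (MorphismProperty.comp_mem _ _ _ hq' hr'),
    fun _ => ⟨fun n c₁ c₂ hs hc => ?_, fun n e hn hs he => ?_⟩⟩
  · have hfold : ∀ e₁ e₂ : B.left.Cubes 1, B.left.start e₁ = B.left.start e₂ →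
        onCubes B.hom e₁ = onCubes B.hom e₂ → e₁ = e₂ := fun e₁ e₂ h₁ h₂ => by
      by_contra h
      exact hB e₁ e₂ ⟨h, h₁, h₂⟩
    have hs' : B.left.start (onCubes p.left c₁) = B.left.start (onCubes p.left c₂) :=
      start_onCubes_eq _ hs
    have hc' : onCubes B.hom (onCubes p.left c₁) = onCubes B.hom (onCubes p.left c₂) := by
      rw [onCubes_hom_left, onCubes_hom_left, hc]
    have key : onCubes q.left (onCubes p.left c₁) = onCubes q.left (onCubes p.left c₂) := by
      have hskel := face_edge_eq B.hom hfold hs' hc'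
      rcases Nat.lt_or_ge n 2 with hn | hn
      · interval_cases n
        · rw [← start_zero (onCubes p.left c₁), hs', start_zero]
        · have := hskel (𝟙 _)
          rw [face_id, face_id] at this
          rw [this]
      · by_contra hne
        refine hC n _ _ ⟨hn, hne, fun φ => ?_⟩
        rw [← onCubes_face q.left, ← onCubes_face q.left, hskel]
    exact congrArg (onCubes r.left) key
  · have hsp : (davisQuotient cs).Spans
        fun i => onCubes C.hom (onCubes q.left (onCubes p.left (e i))) := by
      simpa only [← onCubes_comp, Over.w, Category.assoc] using he
    by_cases h : C.left.Spans fun i => onCubes q.left (onCubes p.left (e i))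
    · exact h.onCubes r.left
    · refine IsAttachment.spans (g := r.left) hr (fun _ _ h => h.2.1)
        ⟨hn, injective_of_spans hsp,
          fun i j => start_onCubes_eq _ (start_onCubes_eq _ (hs i j)), hsp, h⟩

end Cubical

namespace LabeledComplex

theorem isLocal_of_fold {A B : LabeledComplex Γ} {g : A ⟶ B} (hg : fold Γ g) :
    (localIsometries (davisQuotient cs)).isLocal ((toOver cs).map g) := by
  obtain ⟨e₁, e₂, h, hg⟩ := hg
  exact isLocal_of_isIdentification ((toOver cs).map g) hg h.2.1
    ((A.davisMap_eq_iff cs _ _).2 h.2.2)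

/-- Cubes of dimension at least two with the same boundary have the same image in `Y`. -/
theorem IsParallelPair.davisMap_eq {A : LabeledComplex Γ} {n : ℕ} {c₁ c₂ : A.complex.Cubes n}
    (h : A.IsParallelPair c₁ c₂) :
    onCubes (A.davisMap cs) c₁ = onCubes (A.davisMap cs) c₂ := by
  refine davisQuotient_ext_cornerEdge fun i => ?_
  rw [← onCubes_cornerEdge, ← onCubes_cornerEdge]
  exact congrArg _ (h.2.2 1 h.1 (Box.cornerEdge n i))

theorem isLocal_of_cubeIdentification {A B : LabeledComplex Γ} {g : A ⟶ B}
    (hg : cubeIdentification Γ g) :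
    (localIsometries (davisQuotient cs)).isLocal ((toOver cs).map g) := by
  obtain ⟨n, c₁, c₂, h, hg⟩ := hg
  exact isLocal_of_isIdentification ((toOver cs).map g) hg
    (h.2.2 0 (by have := h.1; omega) (Box.corner n)) h.davisMap_eq

/-- A complex that maps to a cube complex which is immersed in `Y` has no edge or cube that could be
identified with a nontrivial reparametrization of itself; therefore, if it is folded, it is itself
immersed in `Y`. -/
theorem IsFolded.isImmersion {B : LabeledComplex Γ} (hB : B.IsFolded) {D : Over (davisQuotient cs)}
    (hD : IsImmersion D.hom) (hD' : D.left.IsCubeComplex) (h : (toOver cs).obj B ⟶ D) :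
    IsImmersion (B.davisMap cs) := by
  -- The images of the two cubes in `D` agree, so `σ` fixes a cube of `D`.
  have reparam : ∀ {n : ℕ} {c₁ c₂ : B.complex.Cubes n}, B.complex.start c₁ = B.complex.start c₂ →
      onCubes (B.davisMap cs) c₁ = onCubes (B.davisMap cs) c₂ → c₁ ≠ c₂ →
        ∀ σ : Box.std n ⟶ Box.std n, B.complex.face σ c₁ ≠ c₂ := by
    intro n c₁ c₂ hs hc hne σ hσ
    have h1 := onCubes_left_eq hD h hs hc
    rw [← hσ] at h1
    have h2 := hD' n (onCubes h.left c₁) σ ((onCubes_face h.left σ c₁).symm.trans h1.symm)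
    rw [h2, face_id] at hσ
    exact hne hσ
  have edges : ∀ e₁ e₂ : B.complex.Cubes 1, B.complex.start e₁ = B.complex.start e₂ →
      onCubes (B.davisMap cs) e₁ = onCubes (B.davisMap cs) e₂ → e₁ = e₂ := by
    intro e₁ e₂ hs he
    by_contra hne
    exact hB.1 e₁ e₂ ⟨reparam hs he hne, hs, (B.davisMap_eq_iff cs _ _).1 he⟩
  -- By induction on the dimension, all proper faces of the two cubes agree.
  intro n
  induction n using Nat.strong_induction_on with
  | _ n ih =>
    intro c₁ c₂ hs hc
    have hskel := face_edge_eq (B.davisMap cs) edges hs hc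
    rcases Nat.lt_or_ge n 2 with hn | hn
    · interval_cases n
      · rw [← start_zero c₁, hs, start_zero]
      · exact edges _ _ hs hc
    · by_contra hne
      refine hB.2 n c₁ c₂ ⟨hn, reparam hs hc hne, fun m hm φ => ih m hm _ _ ?_ ?_⟩
      · rw [start_face, start_face]
        have h0 : (0 : ℕ) < n := by omega
        rw [← Box.corner_comp_edge ⟨0, h0⟩, face_comp, face_comp, hskel]
      · rw [onCubes_face, onCubes_face, hc]

theorem IsCommutingCorner.spans {A : LabeledComplex Γ} {n : ℕ} {e : Fin n → A.complex.Cubes 1}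
    (he : A.IsCommutingCorner n e) :
    (davisQuotient cs).Spans fun i => onCubes (A.davisMap cs) (e i) :=
  davisQuotient_spans_iff.2 fun i j hij => by
    simpa only [davisLabels_davisMap_edge] using he.2.2 hij

theorem completionRound_le {D : Over (davisQuotient cs)} (hD : IsLocalIsometry D.hom)
    (hD' : D.left.IsCubeComplex) :
    completionRound Γ ≤ (completionStep D).inverseImage (toOver cs) := by
  rintro A C g ⟨B, p, q, rfl, hp, hB, hq⟩
  have hp' : (localIsometries (davisQuotient cs)).isLocal ((toOver cs).map p) :=
    (MorphismProperty.multiplicativeClosure_le_iff (fold Γ ⊔ cubeIdentification Γ)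
      ((localIsometries (davisQuotient cs)).isLocal.inverseImage (toOver cs))).2
    (sup_le (fun _ _ _ h => isLocal_of_fold h) fun _ _ _ h => isLocal_of_cubeIdentification h) _ hp
  have hq' : (localIsometries (davisQuotient cs)).isLocal ((toOver cs).map q) :=
    isLocal_of_isAttachment ((toOver cs).map q) hq fun n e he =>
      ⟨by have := he.1.1; omega, he.1.2.1, he.1.spans⟩
  refine ⟨?_, fun ⟨h⟩ => ?_⟩
  · rw [Functor.map_comp]
    exact MorphismProperty.comp_mem _ _ _ hp' hq'
  obtain ⟨hBD, -⟩ := (hp' D hD).2 h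
  have himm := hB.isImmersion hD.1 hD' hBD
  refine ⟨fun n c₁ c₂ hs hc => ?_, fun n (e : Fin n → A.complex.Cubes 1) hn hs he => ?_⟩
  · exact congrArg (onCubes (map q)) (onCubes_left_eq (W := (toOver cs).obj B) himm
      ((toOver cs).map p) hs hc)
  · have hcorner : B.IsCommutingCorner n fun i => onCubes (map p) (e i) := by
      refine ⟨hn, fun i j => start_onCubes_eq (map p) (hs i j), fun i j hij => ?_⟩
      have h1 : Γ.Adj (davisLabels cs (onCubes (A.davisMap cs) (e i)) 0)
        (davisLabels cs (onCubes (A.davisMap cs) (e j)) 0) := davisQuotient_spans_iff.1 he hij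
      rw [davisLabels_davisMap_edge, davisLabels_davisMap_edge] at h1
      have h2 : ∀ i, B.label (onCubes (map p) (e i)) = A.label (e i) := fun i => Hom.label_eq p (e i)
      rw [← h2, ← h2] at h1
      exact h1
    by_cases h : B.complex.Spans fun i => onCubes (map p) (e i)
    · exact h.onCubes (map q)
    · exact IsAttachment.spans (g := map q) hq
        (fun _ _ h => injective_of_spans (h.1.spans (cs := cs))) ⟨hcorner, h⟩

end LabeledComplex

end

/-! ### Direct limits -/

open Limits

section

variable {Y : CubeSet}

theorem exists_onCubes_eq {F : ℕ ⥤ Over Y} {t : Cocone F} (ht : IsColimit t) {n : ℕ}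
    (c : t.pt.left.Cubes n) :
    ∃ (m : ℕ) (c' : (F.obj m).left.Cubes n), onCubes (t.ι.app m).left c' = c :=
  Types.jointly_surjective_of_isColimit
    (isColimitOfPreserves (Over.forget Y ⋙ (evaluation Boxᵒᵖ Type).obj (op (Box.std n))) ht) c

theorem exists_onCubes_map_eq {F : ℕ ⥤ Over Y} {t : Cocone F} (ht : IsColimit t) {n m m' : ℕ}
    {c : (F.obj m).left.Cubes n} {c' : (F.obj m').left.Cubes n}
    (h : onCubes (t.ι.app m).left c = onCubes (t.ι.app m').left c') :
    ∃ (k : ℕ) (f : m ⟶ k) (g : m' ⟶ k),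
      onCubes (F.map f).left c = onCubes (F.map g).left c' :=
  (Types.FilteredColimit.isColimit_eq_iff _
    (isColimitOfPreserves (Over.forget Y ⋙ (evaluation Boxᵒᵖ Type).obj (op (Box.std n))) ht)).1 h

theorem onCubes_cocone {F : ℕ ⥤ Over Y} (t : Cocone F) {m k : ℕ} (f : m ⟶ k) {n : ℕ}
    (c : (F.obj m).left.Cubes n) :
    onCubes (t.ι.app k).left (onCubes (F.map f).left c) = onCubes (t.ι.app m).left c := by
  rw [← onCubes_comp, ← Over.comp_left, t.w]

theorem onCubes_map_map (F : ℕ ⥤ Over Y) {m k l : ℕ} (f : m ⟶ k) (g : k ⟶ l) {n : ℕ}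
    (c : (F.obj m).left.Cubes n) :
    onCubes (F.map g).left (onCubes (F.map f).left c) = onCubes (F.map (f ≫ g)).left c := by
  rw [← onCubes_comp, ← Over.comp_left, F.map_comp]

/-- Finitely many cubes of a sequential colimit with a common corner come from cubes with a common
corner in one of the complexes of the sequence. -/
theorem exists_stage {F : ℕ ⥤ Over Y} {t : Cocone F} (ht : IsColimit t) {ι : Type} [Finite ι]
    {n : ℕ} (c : ι → t.pt.left.Cubes n) (hs : ∀ i j, t.pt.left.start (c i) = t.pt.left.start (c j)) :
    ∃ (m : ℕ) (c' : ι → (F.obj m).left.Cubes n), (∀ i, onCubes (t.ι.app m).left (c' i) = c i) ∧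
      ∀ i j, (F.obj m).left.start (c' i) = (F.obj m).left.start (c' j) := by
  choose m a ha using fun i => exists_onCubes_eq ht (c i)
  obtain ⟨M, hM⟩ := Finite.exists_le m
  let b : ι → (F.obj M).left.Cubes n := fun i => onCubes (F.map (homOfLE (hM i))).left (a i)
  have hb : ∀ i, onCubes (t.ι.app M).left (b i) = c i := fun i =>
    (onCubes_cocone t (homOfLE (hM i)) (a i)).trans (ha i)
  clear_value b
  have hk : ∀ p : ι × ι, ∃ (k : ℕ) (f : M ⟶ k),
      onCubes (F.map f).left ((F.obj M).left.start (b p.1)) =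
        onCubes (F.map f).left ((F.obj M).left.start (b p.2)) := by
    rintro ⟨i, j⟩
    obtain ⟨k, f, g, h⟩ := exists_onCubes_map_eq ht (c := (F.obj M).left.start (b i))
      (c' := (F.obj M).left.start (b j)) (by
        rw [onCubes_start, onCubes_start, hb, hb]
        exact hs i j)
    obtain rfl : f = g := Subsingleton.elim _ _
    exact ⟨k, f, h⟩
  choose k f hf using hk
  obtain ⟨K, hK⟩ := Finite.exists_le k
  have hcomp : ∀ p i (h : M ≤ K), (F.obj K).left.start (onCubes (F.map (homOfLE h)).left (b i)) =
      onCubes (F.map (homOfLE (hK p))).left (onCubes (F.map (f p)).left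
        ((F.obj M).left.start (b i))) := fun p i h => by
    rw [onCubes_map_map, onCubes_start]
    rfl
  by_cases hι : Nonempty ι
  · have hMK : M ≤ K := by
      obtain ⟨i⟩ := hι
      exact (leOfHom (f (i, i))).trans (hK (i, i))
    refine ⟨K, fun i => onCubes (F.map (homOfLE hMK)).left (b i),
      fun i => (onCubes_cocone t (homOfLE hMK) (b i)).trans (hb i), fun i j => ?_⟩
    exact (hcomp (i, j) i hMK).trans ((congrArg _ (hf (i, j))).trans (hcomp (i, j) j hMK).symm)
  · exact ⟨M, b, hb, fun i => (hι ⟨i⟩).elim⟩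

end

section

variable {V : Type} {Γ : SimpleGraph V} {G : Type} [Group G] {cs : CoxeterSystem (racgMatrix Γ) G}

/-- A direct limit of rounds is orthogonal to local isometries and is itself a local isometry: it is
the initial local isometry to `Y` under the complex at which the procedure starts. -/
theorem isLocalIsometry_of_completionSteps {D : Over (davisQuotient cs)}
    (hD : IsLocalIsometry D.hom) {A Z : Over (davisQuotient cs)} {g : A ⟶ Z}
    (hg : (completionStep D).transfiniteCompositionsOfShape ℕ g) (hA : Nonempty (A ⟶ D)) :
    (localIsometries (davisQuotient cs)).isLocal g ∧ IsLocalIsometry Z.hom := by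
  have hle : completionStep D ≤ (localIsometries (davisQuotient cs)).isLocal := fun _ _ _ h => h.1
  refine ⟨MorphismProperty.transfiniteCompositionsOfShape_le _ _ _
    (MorphismProperty.transfiniteCompositionsOfShape_monotone ℕ hle _ hg), ?_⟩
  obtain ⟨hg⟩ := hg
  have hmem : ∀ m, completionStep D (hg.F.map (homOfLE (Order.le_succ m))) :=
    fun m => hg.map_mem m (not_isMax m)
  have hFD : ∀ m, Nonempty (hg.F.obj m ⟶ D) := by
    intro m
    induction m with
    | zero => exact hA.map fun h => hg.isoBot.hom ≫ h
    | succ m ih =>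
      obtain ⟨h⟩ := ih
      exact ⟨((hmem m).1 D hD).2 h |>.choose⟩
  have hincl : ∀ (m n : ℕ) (c : (hg.F.obj m).left.Cubes n),
      onCubes Z.hom (onCubes (hg.incl.app m).left c) = onCubes (hg.F.obj m).hom c :=
    fun m n c => onCubes_hom_left (hg.incl.app m) c
  have hsucc : ∀ (m n : ℕ) (c : (hg.F.obj m).left.Cubes n),
      onCubes (hg.incl.app (Order.succ m)).left
        (onCubes (hg.F.map (homOfLE (Order.le_succ m))).left c) = onCubes (hg.incl.app m).left c :=
    fun m n c => onCubes_cocone (Cocone.mk Z hg.incl) _ c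
  constructor
  · intro n c₁ c₂ hs hc
    obtain ⟨m, c, hcm, hcs⟩ := exists_stage hg.isColimit ![c₁, c₂] (by
      intro i j
      fin_cases i <;> fin_cases j <;> first | rfl | exact hs | exact hs.symm)
    have h0 : onCubes (hg.incl.app m).left (c 0) = c₁ := hcm 0
    have h1 : onCubes (hg.incl.app m).left (c 1) = c₂ := hcm 1
    have h := ((hmem m).2 (hFD m)).1 n (c 0) (c 1) (hcs 0 1)
      (by rw [← hincl, ← hincl, h0, h1, hc])
    rw [← h0, ← h1, ← hsucc m n (c 0), h, hsucc]
  · intro n v d hd he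
    choose e hev hed using he
    rcases Nat.lt_or_ge n 2 with hn | hn
    · interval_cases n
      · exact ⟨v, start_zero v, by rw [← hd, start_zero]⟩
      · exact ⟨e 0, hev 0, by rw [hed, cornerEdge_one]⟩
    · obtain ⟨m, e', hem, hes⟩ := exists_stage hg.isColimit e
        fun i j => (hev i).trans (hev j).symm
      replace hem : ∀ i, onCubes (hg.incl.app m).left (e' i) = e i := hem
      obtain ⟨c, hc⟩ := ((hmem m).2 (hFD m)).2 n e' hn hes
        ⟨d, fun i => (hed i).symm.trans ((congrArg _ (hem i).symm).trans (hincl m 1 (e' i)))⟩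
      have hce : ∀ i, Z.left.cornerEdge (onCubes (hg.incl.app (Order.succ m)).left c) i = e i :=
        fun i => by
          rw [← onCubes_cornerEdge, hc, ← hem i]
          exact hsucc m 1 (e' i)
      refine ⟨onCubes (hg.incl.app (Order.succ m)).left c, ?_, ?_⟩
      · rw [← start_cornerEdge _ ⟨0, by omega⟩]
        exact (congrArg _ (hce _)).trans (hev _)
      · refine davisQuotient_ext_cornerEdge fun i => ?_
        rw [← onCubes_cornerEdge, ← hed]
        exact congrArg _ (hce i)

end

/-! ### Quotients and attachments of cubes -/

namespace CubeSet

/-- The equality of cubes forced on the `n`-cubes of `A` by identifying the cubes related by `R`: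
corresponding faces of related cubes are to be identified. -/
def faceRel (A : CubeSet) (R : ∀ n, A.Cubes n → A.Cubes n → Prop) (n : Box) (c d : A.obj (op n)) :
    Prop :=
  ∃ (m : ℕ) (φ : n ⟶ Box.std m) (c' d' : A.Cubes m),
    R m c' d' ∧ A.map φ.op c' = c ∧ A.map φ.op d' = d

/-- The quotient of `A` by the identification of the cubes related by `R`. -/
def quotient (A : CubeSet) (R : ∀ n, A.Cubes n → A.Cubes n → Prop) : CubeSet where
  obj n := Quot (A.faceRel R n.unop)
  map φ := TypeCat.ofHom (Quot.map (A.map φ) fun _ _ ⟨m, ψ, c', d', h, hc, hd⟩ =>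
    ⟨m, φ.unop ≫ ψ, c', d', h, by rw [← hc]; simp, by rw [← hd]; simp⟩)
  map_id n := ConcreteCategory.hom_ext _ _ fun c => by
    obtain ⟨c, rfl⟩ := Quot.exists_rep c
    exact congrArg (Quot.mk _) (by simp)
  map_comp φ ψ := ConcreteCategory.hom_ext _ _ fun c => by
    obtain ⟨c, rfl⟩ := Quot.exists_rep c
    exact congrArg (Quot.mk _) (by simp)

/-- The projection to the quotient. -/
def quotientMap (A : CubeSet) (R : ∀ n, A.Cubes n → A.Cubes n → Prop) : A ⟶ A.quotient R :=
  homMk (fun n => Quot.mk (A.faceRel R (Box.std n))) fun _ _ => rfl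

variable {A : CubeSet} {R : ∀ n, A.Cubes n → A.Cubes n → Prop}

theorem quotientMap_surjective (n : ℕ) :
    Function.Surjective (onCubes (A.quotientMap R) : A.Cubes n → (A.quotient R).Cubes n) :=
  Quot.exists_rep

theorem onCubes_quotientMap_eq {n : ℕ} {c d : A.Cubes n} (h : R n c d) :
    onCubes (A.quotientMap R) c = onCubes (A.quotientMap R) d :=
  Quot.sound ⟨n, 𝟙 _, c, d, h, face_id c, face_id d⟩

theorem existsUnique_quotient_desc {Z : CubeSet} (h : A ⟶ Z)
    (hR : ∀ n c d, R n c d → onCubes h c = onCubes h d) :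
    ∃! k : A.quotient R ⟶ Z, A.quotientMap R ≫ k = h := by
  refine ⟨homMk (fun n => Quot.lift (onCubes h) ?_) ?_, hom_ext fun _ _ => rfl, fun k hk => ?_⟩
  · rintro _ _ ⟨m, φ, c', d', hcd, rfl, rfl⟩
    exact (onCubes_face h φ c').trans ((congrArg _ (hR m _ _ hcd)).trans (onCubes_face h φ d').symm)
  · intro m n φ c
    obtain ⟨c, rfl⟩ := quotientMap_surjective n c
    exact onCubes_face h φ c
  · refine hom_ext fun n c => ?_
    obtain ⟨c, rfl⟩ := quotientMap_surjective n c
    rw [← onCubes_comp, hk]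
    rfl

theorem exists_isIdentification {n : ℕ} (c₁ c₂ : A.Cubes n) :
    ∃ (B : CubeSet) (g : A ⟶ B), IsIdentification g c₁ c₂ ∧
      ∀ m, Function.Surjective (onCubes g : A.Cubes m → B.Cubes m) := by
  let R : ∀ m, A.Cubes m → A.Cubes m → Prop := fun m c d =>
    (⟨m, c⟩ : Σ m, A.Cubes m) = ⟨n, c₁⟩ ∧ (⟨m, d⟩ : Σ m, A.Cubes m) = ⟨n, c₂⟩
  refine ⟨A.quotient R, A.quotientMap R, ⟨onCubes_quotientMap_eq ⟨rfl, rfl⟩, fun Z h hc =>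
    existsUnique_quotient_desc h ?_⟩, quotientMap_surjective⟩
  rintro m c d ⟨h₁, h₂⟩
  obtain ⟨rfl, h₁⟩ := Sigma.mk.inj_iff.1 h₁
  obtain ⟨-, h₂⟩ := Sigma.mk.inj_iff.1 h₂
  rw [eq_of_heq h₁, eq_of_heq h₂, hc]

/-- A face of the `i`-th of the standard cubes in the disjoint union of `A` and standard cubes. -/
def newCube (A : CubeSet) {I : Type} (dim : I → ℕ) (i : I) {n : Box} (φ : n ⟶ Box.std (dim i)) :
    A.obj (op n) ⊕ Σ i, (n ⟶ Box.std (dim i)) := Sum.inr ⟨i, φ⟩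

/-- The disjoint union of `A` with standard cubes of the dimensions `dim i`. -/
def adjoinCubes (A : CubeSet) {I : Type} (dim : I → ℕ) : CubeSet where
  obj n := A.obj n ⊕ Σ i, (n.unop ⟶ Box.std (dim i))
  map φ := TypeCat.ofHom (Sum.map (A.map φ) (Sigma.map id fun _ ψ => φ.unop ≫ ψ))
  map_id n := ConcreteCategory.hom_ext _ _ fun c => by
    rcases c with c | ⟨i, ψ⟩
    · exact congrArg Sum.inl (by simp)
    · exact congrArg (newCube A dim i) (Category.id_comp ψ)
  map_comp φ χ := ConcreteCategory.hom_ext _ _ fun c => by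
    rcases c with c | ⟨i, ψ⟩
    · exact congrArg Sum.inl (by simp)
    · exact congrArg (newCube A dim i) (Category.assoc χ.unop φ.unop ψ)

/-- The corner edges of the new cubes, and the edges of `A` to which they are to be glued. -/
inductive cornerRel (A : CubeSet) {I : Type} (dim : I → ℕ) (e : ∀ i, Fin (dim i) → A.Cubes 1) :
    ∀ n, (A.adjoinCubes dim).Cubes n → (A.adjoinCubes dim).Cubes n → Prop
  | mk (i : I) (j : Fin (dim i)) :
      cornerRel A dim e 1 (Sum.inr ⟨i, Box.cornerEdge (dim i) j⟩) (Sum.inl (e i j))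

/-- All attachments can be performed at once, and they preserve finiteness. -/
theorem exists_isAttachment (A : CubeSet) (hA : ∀ n, Finite (A.Cubes n))
    (P : ∀ n : ℕ, (Fin n → A.Cubes 1) → Prop) :
    ∃ (B : CubeSet) (g : A ⟶ B), IsAttachment g P ∧ ∀ n, Finite (B.Cubes n) := by
  let I : Type := {S : Set (A.Cubes 1) // ∃ (n : ℕ) (e : Fin n → A.Cubes 1), P n e ∧ Set.range e = S}
  choose dim e hPe hrange using fun i : I => i.2
  have hI : Finite I := by
    have := hA 1
    exact Subtype.finite
  let C := A.adjoinCubes dim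
  let R := A.cornerRel dim e
  let inl : A ⟶ C := homMk (fun n c => Sum.inl c) fun _ _ => rfl
  let b : ∀ i, C.Cubes (dim i) := fun i => Sum.inr ⟨i, 𝟙 _⟩
  have hface : ∀ i {m : ℕ} (φ : Box.std m ⟶ Box.std (dim i)), C.face φ (b i) = Sum.inr ⟨i, φ⟩ :=
    fun i _ φ => congrArg (newCube A dim i) (Category.comp_id φ)
  refine ⟨C.quotient R, inl ≫ C.quotientMap R, ⟨I, dim, e, fun i => onCubes (C.quotientMap R) (b i),
    hPe, fun n e' he' => ⟨⟨Set.range e', n, e', he', rfl⟩, hrange _, fun i hi => ?_⟩,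
    fun i j => ?_, fun Z h z hz => ?_⟩, fun n => ?_⟩
  · exact Subtype.ext ((hrange i).symm.trans hi)
  · rw [← onCubes_cornerEdge, onCubes_comp, cornerEdge, hface]
    exact onCubes_quotientMap_eq (cornerRel.mk i j)
  · let h' : C ⟶ Z := homMk (fun n => Sum.elim (onCubes h) fun p => Z.face p.2 (z p.1)) (by
      rintro m n φ (c | ⟨i, ψ⟩)
      · exact onCubes_face h φ c
      · exact face_comp φ ψ (z i))
    have hh' : inl ≫ h' = h := hom_ext fun _ _ => rfl
    have hb' : ∀ i, onCubes h' (b i) = z i := fun i => face_id (z i)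
    have huniq : ∀ k : C ⟶ Z, inl ≫ k = h → (∀ i, onCubes k (b i) = z i) → k = h' := by
      intro k hk hkb
      refine hom_ext fun n c => ?_
      rcases c with c | ⟨i, ψ⟩
      · exact congrArg (fun f => onCubes f c) (hk.trans hh'.symm)
      · rw [← hface, onCubes_face, onCubes_face, hkb, hb']
    obtain ⟨k, hk, hku⟩ := existsUnique_quotient_desc (R := R) h' (by
      rintro _ _ _ ⟨i, j⟩
      exact hz i j)
    refine ⟨k, ⟨by rw [Category.assoc, hk, hh'], fun i => by rw [← onCubes_comp, hk, hb']⟩, ?_⟩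
    rintro k' ⟨hk', hkb'⟩
    exact hku k' (huniq _ (by rw [← Category.assoc, hk']) hkb')
  · have : Finite (C.Cubes n) := by
      have := hA n
      change Finite (A.Cubes n ⊕ Σ i, (Box.std n ⟶ Box.std (dim i)))
      infer_instance
    exact Finite.of_surjective _ (quotientMap_surjective (A := C) (R := R) n)

/-- The number of parametrized cubes of dimension at most `N`. -/
def cubeCount (N : ℕ) (X : CubeSet) : ℕ := ∑ n ∈ Finset.range (N + 1), Nat.card (X.Cubes n)

theorem cubeCount_lt {A B : CubeSet} (hA : ∀ n, Finite (A.Cubes n)) {g : A ⟶ B}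
    (hg : ∀ m, Function.Surjective (onCubes g : A.Cubes m → B.Cubes m)) {N n : ℕ} (hn : n ≤ N)
    {c₁ c₂ : A.Cubes n} (hne : c₁ ≠ c₂) (hc : onCubes g c₁ = onCubes g c₂) :
    B.cubeCount N < A.cubeCount N := by
  refine Finset.sum_lt_sum (fun m _ => ?_) ⟨n, Finset.mem_range.2 (by omega), ?_⟩
  · have := hA m
    exact Nat.card_le_card_of_surjective _ (hg m)
  · have := hA n
    have := Finite.of_surjective _ (hg n)
    refine lt_of_le_of_ne (Nat.card_le_card_of_surjective _ (hg n)) fun h => hne ?_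
    exact ((Nat.bijective_iff_surjective_and_card _).2 ⟨hg n, h.symm⟩).1 hc

end CubeSet

/-! ### Existence of completions -/

section

universe v u

variable {C : Type u} [Category.{v} C]

/-- Moves that decrease a natural number can be performed until no move is possible. -/
theorem exists_multiplicativeClosure (W : MorphismProperty C) (μ : C → ℕ) {P Q : C → Prop}
    (h : ∀ A, P A → ¬ Q A → ∃ (B : C) (g : A ⟶ B), W g ∧ P B ∧ μ B < μ A) (A : C) (hA : P A) :
    ∃ (B : C) (g : A ⟶ B), W.multiplicativeClosure g ∧ P B ∧ Q B := by
  induction hm : μ A using Nat.strong_induction_on generalizing A with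
  | _ m ih =>
    by_cases hQ : Q A
    · exact ⟨A, 𝟙 A, .id A, hA, hQ⟩
    · obtain ⟨B, g, hg, hB, hlt⟩ := h A hA hQ
      obtain ⟨E, g', hg', hE⟩ := ih (μ B) (hm ▸ hlt) B hB rfl
      exact ⟨E, g ≫ g', MorphismProperty.comp_mem _ _ _ (.of _ hg) hg', hE⟩

/-- If a round can always be performed, then so can a sequence of rounds. -/
theorem exists_transfiniteComposition [HasColimitsOfShape ℕ C] (W : MorphismProperty C)
    {P : C → Prop} (h : ∀ A, P A → ∃ (B : C) (g : A ⟶ B), W g ∧ P B) (A : C) (hA : P A) :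
    ∃ (Z : C) (g : A ⟶ Z), W.transfiniteCompositionsOfShape ℕ g := by
  choose B g hg hB using fun A : {A // P A} => h A.1 A.2
  let X : ℕ → {A // P A} := fun n => n.rec ⟨A, hA⟩ fun _ A => ⟨B A, hB A⟩
  let f : ∀ n, (X n).1 ⟶ (X (n + 1)).1 := fun n => g (X n)
  let F : ℕ ⥤ C := Functor.ofSequence f
  exact ⟨colimit F, colimit.ι F 0, ⟨
    { F := F
      isoBot := Iso.refl _
      incl := (colimit.cocone F).ι
      isColimit := colimit.isColimit F
      fac := Category.id_comp _
      map_mem := fun j _ => by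
        have h1 : F.map (homOfLE (Order.le_succ j)) = f j :=
          Functor.ofSequence_map_homOfLE_succ f j
        rw [h1]
        exact hg (X j) }⟩⟩

end

section

variable {V : Type} {Γ : SimpleGraph V} {G : Type} [Group G] {cs : CoxeterSystem (racgMatrix Γ) G}

theorem exists_over_isIdentification [Finite V] {A : Over (davisQuotient cs)}
    (hA : ∀ n, Finite (A.left.Cubes n)) {n : ℕ} {c₁ c₂ : A.left.Cubes n} (hne : c₁ ≠ c₂)
    (hc : onCubes A.hom c₁ = onCubes A.hom c₂) :
    ∃ (B : Over (davisQuotient cs)) (g : A ⟶ B), IsIdentification g.left c₁ c₂ ∧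
      (∀ n, Finite (B.left.Cubes n)) ∧
        B.left.cubeCount (Nat.card V) < A.left.cubeCount (Nat.card V) := by
  obtain ⟨B, g, hg, hs⟩ := exists_isIdentification c₁ c₂
  obtain ⟨k, hk, -⟩ := hg.2 _ A.hom hc
  exact ⟨Over.mk k, Over.homMk g hk, hg, fun m => have := hA m; Finite.of_surjective _ (hs m),
    cubeCount_lt hA hs (dim_le_card (onCubes A.hom c₁)) hne hg.1⟩

theorem exists_over_isAttachment {A : Over (davisQuotient cs)}
    (hA : ∀ n, Finite (A.left.Cubes n)) (P : ∀ n : ℕ, (Fin n → A.left.Cubes 1) → Prop)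
    (hP : ∀ n e, P n e → (davisQuotient cs).Spans fun i => onCubes A.hom (e i)) :
    ∃ (B : Over (davisQuotient cs)) (g : A ⟶ B), IsAttachment g.left P ∧
      ∀ n, Finite (B.left.Cubes n) := by
  obtain ⟨B, g, hg, hB⟩ := exists_isAttachment A.left hA P
  obtain ⟨I, dim, e, b, hPe, hex, hb, hu⟩ := id hg
  choose z hz using fun i => hP _ _ (hPe i)
  obtain ⟨k, ⟨hk, -⟩, -⟩ := hu _ A.hom z hz
  exact ⟨Over.mk k, Over.homMk g hk, hg, hB⟩

namespace Cubical

theorem exists_completionRound [Finite V] (A : Over (davisQuotient cs))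
    (hA : ∀ n, Finite (A.left.Cubes n)) :
    ∃ (B : Over (davisQuotient cs)) (g : A ⟶ B), completionRound _ g ∧
      ∀ n, Finite (B.left.Cubes n) := by
  obtain ⟨B, p, hp, hB, hB'⟩ := exists_multiplicativeClosure (fold (davisQuotient cs))
    (fun A => A.left.cubeCount (Nat.card V)) (P := fun A => ∀ n, Finite (A.left.Cubes n))
    (Q := fun A => ∀ e₁ e₂, ¬ IsFoldPair A e₁ e₂) (fun A hA hQ => by
      push Not at hQ
      obtain ⟨e₁, e₂, h⟩ := hQ
      obtain ⟨B, g, hg, hB⟩ := exists_over_isIdentification hA h.1 h.2.2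
      exact ⟨B, g, ⟨e₁, e₂, h, hg⟩, hB⟩) A hA
  obtain ⟨C, q, hq, hC, hC'⟩ := exists_multiplicativeClosure (cubeIdentification (davisQuotient cs))
    (fun A => A.left.cubeCount (Nat.card V)) (P := fun A => ∀ n, Finite (A.left.Cubes n))
    (Q := fun A => ∀ (n : ℕ) (c₁ c₂ : A.left.Cubes n), ¬ IsParallelPair A c₁ c₂) (fun A hA hQ => by
      push Not at hQ
      obtain ⟨n, c₁, c₂, h⟩ := hQ
      obtain ⟨B, g, hg, hB⟩ := exists_over_isIdentification hA h.2.1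
        (davisQuotient_ext_cornerEdge fun i => by
          rw [← onCubes_cornerEdge, ← onCubes_cornerEdge]
          exact congrArg _ (h.2.2 (Box.cornerEdge n i)))
      exact ⟨B, g, ⟨n, c₁, c₂, h, hg⟩, hB⟩) B hB
  obtain ⟨D, r, hr, hD⟩ := exists_over_isAttachment hC (IsMissingCorner C) fun n e h => h.2.2.2.1
  exact ⟨D, p ≫ q ≫ r, ⟨B, C, p, q, r, rfl, hp, hB', hq, hC', hr⟩, hD⟩

theorem exists_isStandardCompletion [Finite V] (A : Over (davisQuotient cs))
    (hA : ∀ n, Finite (A.left.Cubes n)) :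
    ∃ (Z : Over (davisQuotient cs)) (g : A ⟶ Z), IsStandardCompletion g :=
  exists_transfiniteComposition (completionRound _) exists_completionRound A hA

end Cubical

namespace LabeledComplex

variable (cs)

/-- A map of complexes over `Y` out of a labeled complex, as a label-preserving map. -/
def homToOfOver {A : LabeledComplex Γ} {Z : Over (davisQuotient cs)} (g : (toOver cs).obj A ⟶ Z) :
    A ⟶ ofOver cs Z :=
  homOfOver cs (B := ofOver cs Z) g.left (by rw [davisMap_ofOver]; exact Over.w g)

theorem exists_completionRound [Finite V] (cs : CoxeterSystem (racgMatrix Γ) G)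
    (A : LabeledComplex Γ) (hA : ∀ n, Finite (A.complex.Cubes n)) :
    ∃ (B : LabeledComplex Γ) (g : A ⟶ B), completionRound Γ g ∧
      ∀ n, Finite (B.complex.Cubes n) := by
  obtain ⟨B, p, hp, hB, hB'⟩ := exists_multiplicativeClosure (fold Γ ⊔ cubeIdentification Γ)
    (fun A => A.complex.cubeCount (Nat.card V)) (P := fun A => ∀ n, Finite (A.complex.Cubes n))
    (Q := IsFolded) (fun A hA hQ => by
      have hid : ∀ {n : ℕ} {c₁ c₂ : A.complex.Cubes n},
          (∀ σ : Box.std n ⟶ Box.std n, A.complex.face σ c₁ ≠ c₂) → c₁ ≠ c₂ :=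
        fun h heq => h (𝟙 _) ((face_id _).trans heq)
      by_cases h1 : ∀ e₁ e₂, ¬ A.IsFoldPair e₁ e₂
      · obtain ⟨n, c₁, c₂, h⟩ : ∃ (n : ℕ) (c₁ c₂ : A.complex.Cubes n), A.IsParallelPair c₁ c₂ := by
          by_contra hno
          exact hQ ⟨h1, fun n c₁ c₂ h => hno ⟨n, c₁, c₂, h⟩⟩
        obtain ⟨B, g, hg, hB⟩ := exists_over_isIdentification (A := (toOver cs).obj A) hA
          (hid h.2.1) h.davisMap_eq
        exact ⟨ofOver cs B, homToOfOver cs g, Or.inr ⟨n, c₁, c₂, h, hg⟩, hB⟩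
      · push Not at h1
        obtain ⟨e₁, e₂, h⟩ := h1
        obtain ⟨B, g, hg, hB⟩ := exists_over_isIdentification (A := (toOver cs).obj A) hA
          (hid h.1) ((A.davisMap_eq_iff cs _ _).2 h.2.2)
        exact ⟨ofOver cs B, homToOfOver cs g, Or.inl ⟨e₁, e₂, h, hg⟩, hB⟩) A hA
  obtain ⟨C, q, hq, hC⟩ := exists_over_isAttachment (A := (toOver cs).obj B) hB
    (fun n e => B.IsCommutingCorner n e ∧ ¬ B.complex.Spans e) fun n e h => h.1.spans
  exact ⟨ofOver cs C, p ≫ homToOfOver cs q, ⟨B, p, homToOfOver cs q, rfl, hp, hB', hq⟩, hC⟩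

theorem exists_isStandardCompletion [Finite V] (cs : CoxeterSystem (racgMatrix Γ) G)
    (A : LabeledComplex Γ) (hA : ∀ n, Finite (A.complex.Cubes n)) :
    ∃ (Ω : LabeledComplex Γ) (g : A ⟶ Ω), IsStandardCompletion g := by
  have : HasColimitsOfShape ℕ (LabeledComplex Γ) :=
    Adjunction.hasColimitsOfShape_of_equivalence (toOver cs)
  exact exists_transfiniteComposition (completionRound Γ) (exists_completionRound cs) A hA

end LabeledComplex

end

/-! ### Comparison of the two completions -/

theorem CubeSet.IsCubeComplex.of_hom {X Y : CubeSet} (hY : Y.IsCubeComplex) (f : X ⟶ Y) :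
    X.IsCubeComplex := fun n c σ h =>
  hY n (onCubes f c) σ ((onCubes_face f σ c).symm.trans (congrArg _ h))

/-- Local objects under the same object along orthogonal maps are canonically isomorphic. -/
theorem exists_iso_of_isLocal {C : Type*} [Category C] {P : ObjectProperty C} {A Z Z' : C}
    {f : A ⟶ Z} {g : A ⟶ Z'} (hf : P.isLocal f) (hg : P.isLocal g) (hZ : P Z) (hZ' : P Z') :
    ∃ Φ : Z ≅ Z', f ≫ Φ.hom = g := by
  obtain ⟨φ, hφ⟩ := (hf Z' hZ').2 g
  obtain ⟨ψ, hψ⟩ := (hg Z hZ).2 f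
  dsimp only at hφ hψ
  refine ⟨⟨φ, ψ, (hf Z hZ).1 ?_, (hg Z' hZ').1 ?_⟩, hφ⟩
  · simp only [Category.comp_id, ← Category.assoc]
    rw [hφ, hψ]
  · simp only [Category.comp_id, ← Category.assoc]
    rw [hψ, hφ]

section

variable {V : Type} {Γ : SimpleGraph V} {G : Type} [Group G] {cs : CoxeterSystem (racgMatrix Γ) G}

theorem LabeledComplex.isFolded_of_isImmersion {A : LabeledComplex Γ}
    (h : IsImmersion (A.davisMap cs)) : A.IsFolded := by
  constructor
  · rintro e₁ e₂ ⟨hne, hs, hl⟩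
    exact hne (𝟙 _) ((face_id _).trans (h 1 e₁ e₂ hs ((A.davisMap_eq_iff cs _ _).2 hl)))
  · intro n c₁ c₂ hp
    exact hp.2.1 (𝟙 _) ((face_id _).trans (h n c₁ c₂
      (hp.2.2 0 (by have := hp.1; omega) (Box.corner n)) hp.davisMap_eq))

theorem LabeledComplex.isCubeFull_of_isLocalIsometry {A : LabeledComplex Γ}
    (h : IsLocalIsometry (A.davisMap cs)) : A.IsCubeFull := fun _ _ he =>
  spans_of_isLocalIsometry h (by have := he.1; omega) he.2.1 he.spans

instance finite_graphCube {P E : Type} [Finite P] [Finite E] (n : ℕ) : Finite (GraphCube P E n) := by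
  let f : GraphCube P E n → P ⊕ E × ZMod 2 := fun c => match n, c with
    | _, .vertex x => Sum.inl x
    | _, .edge a ε => Sum.inr (a, ε)
  refine Finite.of_injective f fun c d h => ?_
  cases c with
  | vertex x =>
    cases d
    exact congrArg _ (Sum.inl.inj h)
  | edge a ε =>
    cases d
    obtain ⟨rfl, rfl⟩ := Prod.mk.inj (Sum.inr.inj h)
    rfl

theorem finite_bouquet_cubes {k : ℕ} (w : Fin k → List V) (n : ℕ) :
    Finite ((bouquet w).Cubes n) :=
  inferInstanceAs (Finite (GraphCube (BouquetVertex w) (BouquetEdge w) n))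

/-- The map from the bouquet to `Y` is the one given by its labels. -/
def bouquetOverIso (cs : CoxeterSystem (racgMatrix Γ) G) {k : ℕ} (w : Fin k → List V) :
    bouquetOver cs w ≅ (LabeledComplex.toOver cs).obj (labeledBouquet Γ w) :=
  Over.isoMk (Iso.refl (bouquet w)) <| (Category.id_comp _).trans
    ((labeledBouquet Γ w).eq_davisMap cs (f := (bouquetOver cs w).hom) fun e => match e with
      | .edge _ _ => rfl).symm

end

end

theorem mainTheorem10 {V : Type} [Finite V] (Γ : SimpleGraph V) {G : Type} [Group G]
    (cs : CoxeterSystem (racgMatrix Γ) G) (H : Subgroup G)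
    (hH : ∀ h ∈ H, IsOfFinOrder h → h = 1) {k : ℕ} (w : Fin k → List V) (hw : ∀ i, w i ≠ [])
    (hgen : Subgroup.closure (Set.range fun i => cs.wordProd (w i)) = H) :
    (∃ (Z : Over (davisQuotient cs)) (ι : bouquetOver cs w ⟶ Z),
      Cubical.IsStandardCompletion ι) ∧
    (∃ (Ω : LabeledComplex Γ) (j : labeledBouquet Γ w ⟶ Ω),
      LabeledComplex.IsStandardCompletion j) ∧
    ∀ (Z : Over (davisQuotient cs)) (ι : bouquetOver cs w ⟶ Z)
      (Ω : LabeledComplex Γ) (j : labeledBouquet Γ w ⟶ Ω),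
      Cubical.IsStandardCompletion ι → LabeledComplex.IsStandardCompletion j →
        Z.left.IsCubeComplex ∧ CubeSet.IsLocalIsometry Z.hom ∧
        Ω.complex.IsCubeComplex ∧ Ω.IsFolded ∧ Ω.IsCubeFull ∧
        ∃! Φ : Z.left ≅ Ω.complex,
          ι.left ≫ Φ.hom = LabeledComplex.map j ∧
          ∀ e : Z.left.Cubes 1,
            CubeSet.onCubes Z.hom e =
              davisQuotientEdge cs (Ω.label (CubeSet.onCubes Φ.hom e)) := by
  refine ⟨Cubical.exists_isStandardCompletion _ (finite_bouquet_cubes w),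
    LabeledComplex.exists_isStandardCompletion cs _ (finite_bouquet_cubes w),
    fun Z ι Ω j hι hj => ?_⟩
  have hwH : ∀ i, cs.wordProd (w i) ∈ H := fun i => hgen ▸ Subgroup.subset_closure ⟨i, rfl⟩
  have hD : CubeSet.IsLocalIsometry (davisCoverOver cs H).hom := davisCoverMap_isLocalIsometry
  have hD' : (davisCoverOver cs H).left.IsCubeComplex := davisCover_isCubeComplex hH
  obtain ⟨f⟩ := nonempty_bouquetOver_hom H w hwH
  have : Limits.PreservesWellOrderContinuousOfShape ℕ (LabeledComplex.toOver (Γ := Γ) cs) :=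
    ⟨fun _ _ => inferInstance⟩
  obtain ⟨hιloc, hZ⟩ := isLocalIsometry_of_completionSteps hD
    (MorphismProperty.transfiniteCompositionsOfShape_monotone ℕ
      (Cubical.completionRound_le (davisCoverOver cs H)) _ hι) ⟨f⟩
  obtain ⟨hjloc, hΩ⟩ := isLocalIsometry_of_completionSteps hD
    (MorphismProperty.transfiniteCompositionsOfShape_map_of_preserves ℕ (LabeledComplex.toOver cs) j
      (MorphismProperty.transfiniteCompositionsOfShape_monotone ℕ
        (LabeledComplex.completionRound_le hD hD') _ hj)) ⟨(bouquetOverIso cs w).inv ≫ f⟩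
  obtain ⟨fZ, -⟩ := (hιloc _ hD).2 f
  obtain ⟨fΩ, -⟩ := (hjloc _ hD).2 ((bouquetOverIso cs w).inv ≫ f)
  refine ⟨hD'.of_hom fZ.left, hZ, hD'.of_hom fΩ.left,
    LabeledComplex.isFolded_of_isImmersion (cs := cs) hΩ.1,
    LabeledComplex.isCubeFull_of_isLocalIsometry (cs := cs) hΩ, ?_⟩
  have hjloc' : (localIsometries (davisQuotient cs)).isLocal
      ((bouquetOverIso cs w).hom ≫ (LabeledComplex.toOver cs).map j) :=
    MorphismProperty.comp_mem _ _ _ (MorphismProperty.of_isIso _ _) hjloc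
  obtain ⟨Φ, hΦ⟩ := exists_iso_of_isLocal hιloc hjloc' hZ hΩ
  refine ⟨(Over.forget _).mapIso Φ, ⟨congrArg CommaMorphism.left hΦ, fun e => ?_⟩, ?_⟩
  · exact (onCubes_hom_left Φ.hom e).symm.trans (Ω.onCubes_davisMap cs _)
  · rintro Ψ ⟨hΨ, hlabel⟩
    have hover : Ψ.hom ≫ Ω.davisMap cs = Z.hom := CubeSet.hom_ext fun n c =>
      davisQuotient_ext_cornerEdge fun i => by
        rw [← CubeSet.onCubes_cornerEdge, ← CubeSet.onCubes_cornerEdge, CubeSet.onCubes_comp,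
          LabeledComplex.onCubes_davisMap, hlabel]
    let Ψ' : Z ⟶ (LabeledComplex.toOver cs).obj Ω := Over.homMk Ψ.hom hover
    have hΨ' : ι ≫ Ψ' = (bouquetOverIso cs w).hom ≫ (LabeledComplex.toOver cs).map j :=
      Over.OverMorphism.ext hΨ
    have h : Ψ' = Φ.hom := (hιloc _ hΩ).1 (hΨ'.trans hΦ.symm)
    exact Iso.ext (congrArg CommaMorphism.left h)
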